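/- Theorem 3.1 (Björner–Lovász–Vrećica–Živaljević Conjecture). For a finite graph $G$, let $M(G)$ be the simplicial complex whose vertices are the edges of $G$ and whose faces are the sets of edges $F$ such that every vertex of $G$ lies in at most one edge of $F$. Let $M_n = M(K_n)$ be the matching complex and $M_{m,n} = M(K_{m,n})$ the chessboard complex, where $K_n$ is the complete graph on $n$ vertices and $K_{m,n}$ is the complete bipartite graph with parts of sizes $m$ and $n$. Put $$\nu_n = \left\lfloor \frac{n+1}{3} \right\rfloor - 1, \qquad \nu_{m,n} = \min\left\{m,\, n,\, \left\lfloor \frac{m+n+1}{3} \right\rfloor\right\} - 1,$$ and let $\tilde H_t(\Delta)$ denote reduced simplicial homology with integer coefficients (the empty set being a face of dimension $-1$, so that $\tilde H_{-1}(\emptyset) = \mathbb{Z}$). Then: 1. for every integer $n \ge 3$, $\tilde H_{\nu_n}(M_n) \neq 0$; 2. for all integers $m, n \ge 0$ with $m + n \ge 3$, $\tilde H_{\nu_{m,n}}(M_{m,n}) \neq 0$. -/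

import Mathlib

/-! ### Reduced simplicial homology over `ℤ` -/

/-- The oriented simplex `v₀ ∧ v₁ ∧ ⋯ ∧ v_k` given by an ordered list of vertices, as an element of
the exterior algebra of the free abelian group on the vertices. Reordering the vertices multiplies
it by the sign of the permutation. The empty list gives `1`, the empty oriented simplex. -/
noncomputable def orientedSimplex {V : Type*} (l : List V) : ExteriorAlgebra ℤ (V →₀ ℤ) :=
  (l.map fun v => ExteriorAlgebra.ι ℤ (Finsupp.single v (1 : ℤ))).prod

/-- The simplicial boundary operator, as contraction with the augmentation `V →₀ ℤ → ℤ` that sends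
every vertex to `1`. On oriented simplices this is the usual alternating sum of facets, see
`simplicialBoundary_orientedSimplex`. The boundary of a vertex is the empty simplex. -/
noncomputable def simplicialBoundary (V : Type*) :
    ExteriorAlgebra ℤ (V →₀ ℤ) →ₗ[ℤ] ExteriorAlgebra ℤ (V →₀ ℤ) :=
  CliffordAlgebra.contractLeft (Q := (0 : QuadraticForm ℤ (V →₀ ℤ)))
    (Finsupp.linearCombination ℤ fun _ : V => (1 : ℤ))

/-- `∂ (v₀ ∧ ⋯ ∧ v_k) = ∑ i, (-1) ^ i • (v₀ ∧ ⋯ ∧ v̂ᵢ ∧ ⋯ ∧ v_k)`. -/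
theorem simplicialBoundary_orientedSimplex {V : Type*} (l : List V) :
    simplicialBoundary V (orientedSimplex l) =
      ∑ i ∈ Finset.range l.length, (-1 : ℤ) ^ i • orientedSimplex (l.eraseIdx i) := by
  induction l with
  | nil => exact CliffordAlgebra.contractLeft_one _ _
  | cons v l ih =>
    have h : simplicialBoundary V (orientedSimplex (v :: l)) =
        orientedSimplex l - ExteriorAlgebra.ι ℤ (Finsupp.single v (1 : ℤ)) *
          simplicialBoundary V (orientedSimplex l) := by
      have h1 : orientedSimplex (v :: l) =
          ExteriorAlgebra.ι ℤ (Finsupp.single v (1 : ℤ)) * orientedSimplex l := by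
        simp [orientedSimplex]
      rw [h1]
      refine (CliffordAlgebra.contractLeft_ι_mul _ _ _).trans ?_
      simp [simplicialBoundary]
    rw [h, ih, List.length_cons, Finset.sum_range_succ', Finset.mul_sum]
    simp only [List.eraseIdx_cons_succ, List.eraseIdx_cons_zero, pow_zero, one_smul]
    rw [sub_eq_add_neg, add_comm, ← Finset.sum_neg_distrib]
    congr 1
    refine Finset.sum_congr rfl fun i _ => ?_
    rw [mul_smul_comm, pow_succ, mul_neg_one, neg_smul]
    simp only [orientedSimplex, List.map_cons, List.prod_cons]

/-- The group `C_t(K)` of the augmented oriented chain complex of `K`: it is generated by the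
oriented simplices on the `t`-dimensional faces of `K`, that is, those with `t + 1` vertices, where
the empty set counts as a face of dimension `-1`. -/
noncomputable def simplicialChains {V : Type*} [DecidableEq V] (K : PreAbstractSimplicialComplex V)
    (t : ℤ) : Submodule ℤ (ExteriorAlgebra ℤ (V →₀ ℤ)) :=
  Submodule.span ℤ {x | ∃ l : List V, l.Nodup ∧ (l.length : ℤ) = t + 1 ∧
    (l.toFinset = ∅ ∨ l.toFinset ∈ K) ∧ x = orientedSimplex l}

/-- The group `Z_t(K)` of reduced `t`-cycles. -/
noncomputable def simplicialCycles {V : Type*} [DecidableEq V] (K : PreAbstractSimplicialComplex V)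
    (t : ℤ) : Submodule ℤ (ExteriorAlgebra ℤ (V →₀ ℤ)) :=
  simplicialChains K t ⊓ LinearMap.ker (simplicialBoundary V)

/-- The group `B_t(K)` of `t`-boundaries. -/
noncomputable def simplicialBoundaries {V : Type*} [DecidableEq V]
    (K : PreAbstractSimplicialComplex V) (t : ℤ) : Submodule ℤ (ExteriorAlgebra ℤ (V →₀ ℤ)) :=
  (simplicialChains K (t + 1)).map (simplicialBoundary V)

theorem simplicialBoundaries_le_cycles {V : Type*} [DecidableEq V]
    (K : PreAbstractSimplicialComplex V) (t : ℤ) :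
    simplicialBoundaries K t ≤ simplicialCycles K t := by
  rw [simplicialBoundaries, simplicialChains, Submodule.map_span_le]
  rintro x ⟨l, hl, hlen, hK, rfl⟩
  refine ⟨?_, CliffordAlgebra.contractLeft_contractLeft _ _⟩
  rw [simplicialBoundary_orientedSimplex]
  refine Submodule.sum_mem _ fun i hi => Submodule.smul_mem _ _ (Submodule.subset_span ?_)
  have hi' : i < l.length := Finset.mem_range.1 hi
  refine ⟨l.eraseIdx i, hl.sublist (List.eraseIdx_sublist _ _), ?_, ?_, rfl⟩
  · rw [List.length_eraseIdx_of_lt hi']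
    omega
  · have hsub : (l.eraseIdx i).toFinset ⊆ l.toFinset := fun v hv =>
      List.mem_toFinset.2 ((List.eraseIdx_sublist l i).subset (List.mem_toFinset.1 hv))
    rcases (l.eraseIdx i).toFinset.eq_empty_or_nonempty with h | h
    · exact Or.inl h
    · rcases hK with h0 | hK
      · exact Or.inl (Finset.subset_empty.1 (h0 ▸ hsub))
      · exact Or.inr ((K.isRelLowerSet_faces hK).2 hsub h)

/-- The reduced integral simplicial homology group `H̃_t(K) = Z_t(K) / B_t(K)`, for `t : ℤ`. -/
abbrev reducedHomology {V : Type*} [DecidableEq V] (K : PreAbstractSimplicialComplex V)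
    (t : ℤ) : Type _ :=
  simplicialCycles K t ⧸
    (simplicialBoundaries K t).comap (simplicialCycles K t).subtype

/-! ### Matching complexes and chessboard complexes -/

/-- The matching complex `M(G)` of a graph `G`: its vertices are the edges of `G`, and its faces are
the nonempty finite sets `F` of edges of `G` such that each vertex of `G` lies in at most one
edge of `F`. -/
def matchingComplexOf {V : Type*} (G : SimpleGraph V) : PreAbstractSimplicialComplex (Sym2 V) where
  faces := {F | F.Nonempty ∧ (∀ e ∈ F, e ∈ G.edgeSet) ∧
    ∀ v : V, ∀ e ∈ F, ∀ f ∈ F, v ∈ e → v ∈ f → e = f}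
  isRelLowerSet_faces := fun _ h => ⟨h.1, fun _ hsub hne => ⟨hne, fun e he => h.2.1 e (hsub he),
    fun v e he f hf => h.2.2 v e (hsub he) f (hsub hf)⟩⟩

/-- The matching complex `M_n`, of the complete graph on `n` vertices. -/
def matchingComplex (n : ℕ) : PreAbstractSimplicialComplex (Sym2 (Fin n)) :=
  matchingComplexOf (⊤ : SimpleGraph (Fin n))

/-- The chessboard complex `M_{m,n}`, the matching complex of the complete bipartite graph with
parts of sizes `m` and `n`. -/
def chessboardComplex (m n : ℕ) : PreAbstractSimplicialComplex (Sym2 (Fin m ⊕ Fin n)) :=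
  matchingComplexOf (completeBipartiteGraph (Fin m) (Fin n))

/-- `ν_n = ⌊(n + 1) / 3⌋ - 1`; integer division by `3` is the floor of the quotient. -/
def nuMatching (n : ℕ) : ℤ := ((n : ℤ) + 1) / 3 - 1

/-- `ν_{m,n} = min {m, n, ⌊(m + n + 1) / 3⌋} - 1`. -/
def nuChessboard (m n : ℕ) : ℤ :=
  min (m : ℤ) (min (n : ℤ) (((m : ℤ) + n + 1) / 3)) - 1

/-! Homology is detected by a cocycle modulo 3. Matchings are monomials in the exterior algebra on
the edges, and ∂(e * y) = y - e * ∂y for an edge e. It suffices to find an integral cycle z and a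
cochain f with values in `ZMod 3` that kills boundaries and has f z = 1. The cochain is built on the
matchings of the complete graph and restricts to every graph G; only z has to live in G. So one
construction serves both families.

On 3k or 3k + 1 vertices, z is a product of k factors ab - bc, one for each of k disjoint paths
a-b-c. The cochain grows with it: `IsTriangularCocycle.exists_extension` turns f on S into F on S ∪
{a, b, c}, with one more edge and F((ab - bc) * z) = f z. For F to be a cocycle on matchings that
join a, b, c to s, t, u in S, the contraction of f with the triangle stu must be a coboundary. This
condition is therefore part of `IsTriangularCocycle`, and most of the work is to show that F
inherits it. The modulus is 3 because a triangle has three edges: ∂(st + tu + us) = 3. The further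
primitives needed come from the vanishing theorem `exists_eq_comp_simplicialBoundary`, which applies
because 3k ≤ #S.

On 3p + 5 vertices, such a cycle on 3p vertices is multiplied by the hexagon M_{2,3}, and the
cocycle is carried over through the matchings containing one fixed edge
(`HasDetectedCycle.exists_hexagon`). If one side of a chessboard is at least twice the other, the
degree is the top one, and a cycle detected on a smaller board cannot become a boundary
(`nontrivial_reducedHomology_of_vertexCover`). -/

/-- The generator of the exterior algebra that corresponds to the edge `uv`. -/
noncomputable def edgeGen {V : Type*} (u v : V) : ExteriorAlgebra ℤ (Sym2 V →₀ ℤ) :=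
  ExteriorAlgebra.ι ℤ (Finsupp.single s(u, v) (1 : ℤ))

/-- `mod 3` cochains on matchings. -/
abbrev MatchingCochain (V : Type*) := ExteriorAlgebra ℤ (Sym2 V →₀ ℤ) →ₗ[ℤ] ZMod 3

/-- Products of `p` pairwise disjoint edges with end points in `S`. -/
inductive IsMatchingMonomial {V : Type*} [DecidableEq V] :
    Finset V → ℕ → ExteriorAlgebra ℤ (Sym2 V →₀ ℤ) → Prop
  | one (S : Finset V) : IsMatchingMonomial S 0 1
  | mul {S : Finset V} {p : ℕ} {y : ExteriorAlgebra ℤ (Sym2 V →₀ ℤ)} (u v : V) (hu : u ∈ S)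
      (hv : v ∈ S) (huv : u ≠ v) (hy : IsMatchingMonomial (S \ {u, v}) p y) :
      IsMatchingMonomial S (p + 1) (edgeGen u v * y)

/-- The span of the oriented matchings with `p` edges inside `S`. -/
noncomputable def matchingChains {V : Type*} [DecidableEq V] (S : Finset V) (p : ℕ) :
    Submodule ℤ (ExteriorAlgebra ℤ (Sym2 V →₀ ℤ)) :=
  Submodule.span ℤ {w | IsMatchingMonomial S p w}

/-! ### Matchings as exterior monomials, and cochains prescribed around one vertex -/

section Algebra

variable {V : Type*}

theorem edgeGen_comm (u v : V) : edgeGen u v = edgeGen v u := by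
  simp only [edgeGen, Sym2.eq_swap]

theorem edgeGen_mul_swap (a b c d : V) : edgeGen a b * edgeGen c d = -(edgeGen c d * edgeGen a b) :=
  eq_neg_of_add_eq_zero_left (ExteriorAlgebra.ι_add_mul_swap _ _)

theorem edgeGen_mul_left_swap (a b c d : V) (y : ExteriorAlgebra ℤ (Sym2 V →₀ ℤ)) :
    edgeGen a b * (edgeGen c d * y) = -(edgeGen c d * (edgeGen a b * y)) := by
  rw [← mul_assoc, edgeGen_mul_swap, neg_mul, mul_assoc]

theorem simplicialBoundary_edgeGen_mul (u v : V) (y : ExteriorAlgebra ℤ (Sym2 V →₀ ℤ)) :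
    simplicialBoundary (Sym2 V) (edgeGen u v * y) =
      y - edgeGen u v * simplicialBoundary (Sym2 V) y := by
  refine (CliffordAlgebra.contractLeft_ι_mul _ _ _).trans ?_
  simp [simplicialBoundary, edgeGen]

theorem simplicialBoundary_one :
    simplicialBoundary (Sym2 V) (1 : ExteriorAlgebra ℤ (Sym2 V →₀ ℤ)) = 0 :=
  CliffordAlgebra.contractLeft_one _ _

variable [DecidableEq V]

theorem IsMatchingMonomial.mono {S T : Finset V} {p : ℕ} {w : ExteriorAlgebra ℤ (Sym2 V →₀ ℤ)}
    (h : IsMatchingMonomial S p w) (hST : S ⊆ T) : IsMatchingMonomial T p w := by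
  induction h generalizing T with
  | one S => exact .one _
  | mul u v hu hv huv _ ih =>
    exact .mul u v (hST hu) (hST hv) huv (ih (Finset.sdiff_subset_sdiff hST le_rfl))

theorem matchingChains_mono {S T : Finset V} (hST : S ⊆ T) (p : ℕ) :
    matchingChains S p ≤ matchingChains T p :=
  Submodule.span_mono fun _ h => IsMatchingMonomial.mono h hST

theorem edgeGen_mul_mem {S T : Finset V} {p : ℕ} {y : ExteriorAlgebra ℤ (Sym2 V →₀ ℤ)} {u v : V}
    (hy : y ∈ matchingChains T p) (hu : u ∈ S) (hv : v ∈ S) (huv : u ≠ v) (hT : T ⊆ S \ {u, v}) :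
    edgeGen u v * y ∈ matchingChains S (p + 1) := by
  have : matchingChains T p ≤
      (matchingChains S (p + 1)).comap (LinearMap.mulLeft ℤ (edgeGen u v)) :=
    Submodule.span_le.2 fun w hw => Submodule.subset_span (.mul u v hu hv huv (hw.mono hT))
  exact this hy

/-- The truncated `p - 1` is harmless: for p = 0 the boundary is zero. This form applies without a
case split on p. -/
theorem simplicialBoundary_mem {S : Finset V} {p : ℕ} {y : ExteriorAlgebra ℤ (Sym2 V →₀ ℤ)}
    (hy : y ∈ matchingChains S p) : simplicialBoundary (Sym2 V) y ∈ matchingChains S (p - 1) := by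
  have : matchingChains S p ≤ (matchingChains S (p - 1)).comap (simplicialBoundary (Sym2 V)) := by
    clear hy
    refine Submodule.span_le.2 fun w hw => ?_
    induction hw with
    | one S => simp [simplicialBoundary_one]
    | @mul S p y u v hu hv huv hy ih =>
      simp only [Submodule.comap_coe, Set.mem_preimage, SetLike.mem_coe] at ih ⊢
      rw [simplicialBoundary_edgeGen_mul, Nat.add_sub_cancel]
      refine sub_mem (matchingChains_mono Finset.sdiff_subset _ (Submodule.subset_span hy)) ?_
      cases hy with
      | one => simp [simplicialBoundary_one]
      | mul => exact edgeGen_mul_mem ih hu hv huv le_rfl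
  exact this hy

theorem simplicialBoundary_mem_of_succ {S : Finset V} {p : ℕ}
    {y : ExteriorAlgebra ℤ (Sym2 V →₀ ℤ)} (hy : y ∈ matchingChains S (p + 1)) :
    simplicialBoundary (Sym2 V) y ∈ matchingChains S p := by
  simpa only [Nat.add_sub_cancel] using simplicialBoundary_mem hy

/-- Edges anticommute, so the edge at a, if there is one, can be moved to the front up to sign. S
and T are kept apart because the induction shrinks both. -/
theorem IsMatchingMonomial.vertex {S T : Finset V} {a : V} {p : ℕ}
    {w : ExteriorAlgebra ℤ (Sym2 V →₀ ℤ)} (h : IsMatchingMonomial T p w) (hT : T ⊆ insert a S) :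
    IsMatchingMonomial (S \ {a}) p w ∨ ∃ u ∈ S, u ≠ a ∧ u ∈ T ∧ ∃ q, q + 1 = p ∧ ∃ y,
      IsMatchingMonomial ((T \ {a, u}) ∩ S) q y ∧ (w = edgeGen a u * y ∨ w = -(edgeGen a u * y)) := by
  induction h generalizing S with
  | one => exact Or.inl (.one _)
  | @mul T p y u v hu hv huv hy ih =>
    by_cases hua : u = a
    · subst hua
      refine Or.inr ⟨v, by grind, huv.symm, hv, p, rfl, y, hy.mono ?_, Or.inl rfl⟩
      grind
    by_cases hva : v = a
    · subst hva
      refine Or.inr ⟨u, by grind, huv, hu, p, rfl, y, hy.mono ?_, Or.inl (by rw [edgeGen_comm])⟩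
      grind
    rcases @ih (S \ {u, v}) (by grind) with h | ⟨x, hx, hxa, hxT, q, rfl, z, hz, hw⟩
    · exact Or.inl (.mul u v (by grind) (by grind) huv (h.mono (by grind)))
    · refine Or.inr ⟨x, by grind, hxa, by grind, q + 1, rfl, edgeGen u v * z,
        .mul u v (by grind) (by grind) huv (hz.mono (by grind)), ?_⟩
      rcases hw with rfl | rfl
      · exact Or.inr (edgeGen_mul_left_swap _ _ _ _ _)
      · left
        rw [mul_neg, edgeGen_mul_left_swap, neg_neg]

/-- To show that a cochain vanishes on matchings, distinguish whether a given vertex is covered. -/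
theorem cochain_eq_zero_of_vertex {S : Finset V} {a : V} {p : ℕ} (f : MatchingCochain V)
    (h0 : ∀ y ∈ matchingChains S p, f y = 0)
    (h1 : ∀ u ∈ S, ∀ q, q + 1 = p → ∀ y ∈ matchingChains (S \ {u}) q, f (edgeGen a u * y) = 0) :
    ∀ w ∈ matchingChains (insert a S) p, f w = 0 := by
  have : matchingChains (insert a S) p ≤ LinearMap.ker f := by
    refine Submodule.span_le.2 fun w hw => ?_
    rcases IsMatchingMonomial.vertex (S := S) hw le_rfl with h | ⟨u, hu, -, -, q, hq, y, hy, rfl | rfl⟩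
    · exact h0 w (Submodule.subset_span (h.mono Finset.sdiff_subset))
    · exact h1 u hu q hq y (Submodule.subset_span (hy.mono (by grind)))
    · simp [h1 u hu q hq y (Submodule.subset_span (hy.mono (by grind)))]
  exact fun w hw => this hw

theorem map_eq_self_of_mem {S : Finset V} {p : ℕ} {y : ExteriorAlgebra ℤ (Sym2 V →₀ ℤ)}
    (hy : y ∈ matchingChains S p) (φ : (Sym2 V →₀ ℤ) →ₗ[ℤ] (Sym2 V →₀ ℤ))
    (hφ : ∀ u ∈ S, ∀ v ∈ S, φ (Finsupp.single s(u, v) 1) = Finsupp.single s(u, v) 1) :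
    ExteriorAlgebra.map φ y = y := by
  have : matchingChains S p ≤ LinearMap.eqLocus (ExteriorAlgebra.map φ).toLinearMap LinearMap.id := by
    clear hy
    refine Submodule.span_le.2 fun w hw => ?_
    induction hw with
    | one S => simp [LinearMap.mem_eqLocus]
    | @mul S p y u v hu hv huv hy ih =>
      have := ih (fun u hu v hv => hφ u (by grind) v (by grind))
      simp only [SetLike.mem_coe, LinearMap.mem_eqLocus, AlgHom.toLinearMap_apply,
        LinearMap.id_apply] at this ⊢
      rw [map_mul, this, edgeGen, ExteriorAlgebra.map_apply_ι, hφ u hu v hv]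
  exact this hy

theorem contractLeft_eq_zero_of_mem {S : Finset V} {p : ℕ} {y : ExteriorAlgebra ℤ (Sym2 V →₀ ℤ)}
    (hy : y ∈ matchingChains S p) (φ : (Sym2 V →₀ ℤ) →ₗ[ℤ] ℤ)
    (hφ : ∀ u ∈ S, ∀ v ∈ S, φ (Finsupp.single s(u, v) 1) = 0) :
    CliffordAlgebra.contractLeft (Q := (0 : QuadraticForm ℤ (Sym2 V →₀ ℤ))) φ y = 0 := by
  have : matchingChains S p ≤ LinearMap.ker
      (CliffordAlgebra.contractLeft (Q := (0 : QuadraticForm ℤ (Sym2 V →₀ ℤ))) φ) := by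
    clear hy
    refine Submodule.span_le.2 fun w hw => ?_
    induction hw with
    | one S => exact CliffordAlgebra.contractLeft_one _ _
    | @mul S p y u v hu hv huv hy ih =>
      have h := ih (fun u hu v hv => hφ u (by grind) v (by grind))
      refine (CliffordAlgebra.contractLeft_ι_mul _ _ _).trans ?_
      rw [SetLike.mem_coe, LinearMap.mem_ker] at h
      rw [h, hφ u hu v hv]
      simp
  exact this hy

/-- Cochains may be prescribed independently on the matchings that avoid a vertex `a` and on those
that contain a given edge at `a`. -/
theorem exists_cochain_vertex {S : Finset V} {a : V} (ha : a ∉ S) (f0 : MatchingCochain V)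
    (f1 : V → MatchingCochain V) :
    ∃ F : MatchingCochain V, (∀ p, ∀ y ∈ matchingChains S p, F y = f0 y) ∧
      ∀ u ∈ S, ∀ p, ∀ y ∈ matchingChains (S \ {u}) p, F (edgeGen a u * y) = f1 u y := by
  classical
  let φ : (Sym2 V →₀ ℤ) →ₗ[ℤ] (Sym2 V →₀ ℤ) :=
    Finsupp.linearCombination ℤ fun e => if a ∈ e then 0 else Finsupp.single e 1
  have hφ : ∀ u v, φ (Finsupp.single s(u, v) 1) =
      if a = u ∨ a = v then 0 else Finsupp.single s(u, v) 1 := by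
    intro u v
    simp [φ, Finsupp.linearCombination_single]
  let D : V → ExteriorAlgebra ℤ (Sym2 V →₀ ℤ) →ₗ[ℤ] ExteriorAlgebra ℤ (Sym2 V →₀ ℤ) := fun u =>
    CliffordAlgebra.contractLeft (Q := (0 : QuadraticForm ℤ (Sym2 V →₀ ℤ)))
      (Finsupp.lapply s(a, u))
  have hD : ∀ t, ∀ {p : ℕ}, ∀ y ∈ matchingChains S p, D t y = 0 := fun t p y hy => by
    refine contractLeft_eq_zero_of_mem hy _ fun u hu v hv => ?_
    have : s(u, v) ≠ s(a, t) := by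
      intro h
      rcases Sym2.eq_iff.1 h with h | h <;> grind
    simp [this]
  -- φ kills the edges at a, so the first summand sees only matchings that avoid a. Contraction with
  -- the coordinate of au strips that edge off and kills matchings that avoid a or use another edge
  -- at a.
  refine ⟨f0 ∘ₗ (ExteriorAlgebra.map φ).toLinearMap + ∑ u ∈ S, f1 u ∘ₗ D u, fun p y hy => ?_,
    fun u hu p y hy => ?_⟩
  · have h1 : ExteriorAlgebra.map φ y = y := by
      refine map_eq_self_of_mem hy _ fun u hu v hv => ?_
      rw [hφ, if_neg (by grind)]
    simp only [LinearMap.add_apply, LinearMap.comp_apply, LinearMap.sum_apply,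
      AlgHom.toLinearMap_apply, h1]
    rw [Finset.sum_eq_zero, add_zero]
    intro t _
    rw [hD t y hy, map_zero]
  · have h1 : ExteriorAlgebra.map φ (edgeGen a u) = 0 := by
      rw [edgeGen, ExteriorAlgebra.map_apply_ι, hφ, if_pos (by simp), map_zero]
    have h2 : ∀ t ∈ S, D t (edgeGen a u * y) = if t = u then y else 0 := by
      intro t _
      have hy0 := hD t y (matchingChains_mono Finset.sdiff_subset _ hy)
      refine (CliffordAlgebra.contractLeft_ι_mul _ _ _).trans ?_
      have h3 : (s(a, u) = s(a, t)) ↔ t = u := by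
        rw [Sym2.eq_iff]
        grind
      change _ - _ * D t y = _
      rw [hy0]
      simp only [Finsupp.lapply_apply, Finsupp.single_apply, h3]
      split_ifs <;> simp
    simp only [LinearMap.add_apply, LinearMap.comp_apply, LinearMap.sum_apply,
      AlgHom.toLinearMap_apply, map_mul, h1, zero_mul, map_zero, zero_add]
    rw [Finset.sum_congr rfl fun t ht => by rw [h2 t ht], Finset.sum_eq_single_of_mem u hu]
    · simp
    · intro t _ htu
      simp [htu]

end Algebra

/-! ### Cochains around two and three vertices, and extension by a triangle -/

section Vertices

variable {V : Type*} [DecidableEq V]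

/-- Case distinction on how two given vertices are covered. -/
theorem cochain_eq_zero_of_two_vertices {S : Finset V} {b c : V} (hc : c ∉ S)
    (hbc : b ≠ c) {p : ℕ} (f : MatchingCochain V) (h0 : ∀ y ∈ matchingChains S p, f y = 0)
    (h1 : ∀ q, q + 1 = p → ∀ y ∈ matchingChains S q, f (edgeGen b c * y) = 0)
    (h2 : ∀ u ∈ S, ∀ q, q + 1 = p → ∀ y ∈ matchingChains (S \ {u}) q, f (edgeGen b u * y) = 0)
    (h3 : ∀ u ∈ S, ∀ q, q + 1 = p → ∀ y ∈ matchingChains (S \ {u}) q, f (edgeGen c u * y) = 0)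
    (h4 : ∀ u ∈ S, ∀ v ∈ S, u ≠ v → ∀ q, q + 2 = p → ∀ y ∈ matchingChains (S \ {u, v}) q,
      f (edgeGen b u * (edgeGen c v * y)) = 0) :
    ∀ w ∈ matchingChains (insert b (insert c S)) p, f w = 0 := by
  refine cochain_eq_zero_of_vertex f (cochain_eq_zero_of_vertex f h0 h3) ?_
  intro u hu q hq y hy
  rcases Finset.mem_insert.1 hu with rfl | hu
  · exact h1 q hq y (matchingChains_mono (by grind) _ hy)
  · have huc : u ≠ c := fun h => hc (h ▸ hu)
    refine cochain_eq_zero_of_vertex (S := S \ {u}) (a := c) (p := q)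
      (f ∘ₗ LinearMap.mulLeft ℤ (edgeGen b u)) (fun y hy => h2 u hu q hq y hy) ?_ y
      (matchingChains_mono (by grind) _ hy)
    intro v hv r hr y hy
    exact h4 u hu v (by grind) (by grind) r (by omega) y (matchingChains_mono (by grind) _ hy)

/-- Cochains may be prescribed independently on the ways two given vertices are covered. -/
theorem exists_cochain_two_vertices {S : Finset V} {b c : V} (hb : b ∉ S) (hc : c ∉ S)
    (hbc : b ≠ c) (f0 fbc : MatchingCochain V) (fb fc : V → MatchingCochain V)
    (fbc' : V → V → MatchingCochain V) :
    ∃ F : MatchingCochain V, (∀ p, ∀ y ∈ matchingChains S p, F y = f0 y) ∧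
      (∀ p, ∀ y ∈ matchingChains S p, F (edgeGen b c * y) = fbc y) ∧
      (∀ u ∈ S, ∀ p, ∀ y ∈ matchingChains (S \ {u}) p, F (edgeGen b u * y) = fb u y) ∧
      (∀ u ∈ S, ∀ p, ∀ y ∈ matchingChains (S \ {u}) p, F (edgeGen c u * y) = fc u y) ∧
      ∀ u ∈ S, ∀ v ∈ S, u ≠ v → ∀ p, ∀ y ∈ matchingChains (S \ {u, v}) p,
        F (edgeGen b u * (edgeGen c v * y)) = fbc' u v y := by
  obtain ⟨G0, hG0, hG0'⟩ := exists_cochain_vertex hc f0 fc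
  have hex : ∀ u : V, ∃ F : MatchingCochain V,
      (∀ p, ∀ y ∈ matchingChains (S \ {u}) p, F y = fb u y) ∧
      ∀ v ∈ S \ {u}, ∀ p, ∀ y ∈ matchingChains ((S \ {u}) \ {v}) p,
        F (edgeGen c v * y) = fbc' u v y := fun u =>
    exists_cochain_vertex (S := S \ {u}) (a := c) (by grind) _ _
  choose G hG hG' using hex
  obtain ⟨F, hF, hF'⟩ := exists_cochain_vertex (S := insert c S) (a := b) (by grind) G0
    (fun u => if u = c then fbc else G u)
  refine ⟨F, fun p y hy => ?_, fun p y hy => ?_, fun u hu p y hy => ?_, fun u hu p y hy => ?_,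
    fun u hu v hv huv p y hy => ?_⟩
  · rw [hF p y (matchingChains_mono (by grind) _ hy), hG0 p y hy]
  · rw [hF' c (by grind) p y (matchingChains_mono (by grind) _ hy), if_pos rfl]
  · rw [hF' u (by grind) p y (matchingChains_mono (by grind) _ hy), if_neg (by grind),
      hG u p y hy]
  · rw [hF (p + 1) _ (edgeGen_mul_mem hy (by grind) (by grind) (by grind) (by grind)),
      hG0' u hu p y hy]
  · rw [hF' u (by grind) (p + 1) _
      (edgeGen_mul_mem hy (by grind) (by grind) (by grind) (by grind)), if_neg (by grind),
      hG' u v (by grind) p y (matchingChains_mono (by grind) _ hy)]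

/-- Case distinction on how three given vertices are covered. -/
theorem cochain_eq_zero_of_three_vertices {S : Finset V} {a b c : V} (hb : b ∉ S)
    (hc : c ∉ S) (hab : a ≠ b) (hac : a ≠ c) (hbc : b ≠ c) {p : ℕ} (f : MatchingCochain V)
    (h0 : ∀ y ∈ matchingChains S p, f y = 0)
    (h1 : ∀ q, q + 1 = p → ∀ y ∈ matchingChains S q, f (edgeGen b c * y) = 0)
    (h2 : ∀ q, q + 1 = p → ∀ y ∈ matchingChains S q, f (edgeGen c a * y) = 0)
    (h3 : ∀ q, q + 1 = p → ∀ y ∈ matchingChains S q, f (edgeGen a b * y) = 0)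
    (h4 : ∀ s ∈ S, ∀ q, q + 1 = p → ∀ y ∈ matchingChains (S \ {s}) q, f (edgeGen a s * y) = 0)
    (h5 : ∀ s ∈ S, ∀ q, q + 1 = p → ∀ y ∈ matchingChains (S \ {s}) q, f (edgeGen b s * y) = 0)
    (h6 : ∀ s ∈ S, ∀ q, q + 1 = p → ∀ y ∈ matchingChains (S \ {s}) q, f (edgeGen c s * y) = 0)
    (h7 : ∀ s ∈ S, ∀ q, q + 2 = p → ∀ y ∈ matchingChains (S \ {s}) q,
      f (edgeGen a s * (edgeGen b c * y)) = 0)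
    (h8 : ∀ s ∈ S, ∀ q, q + 2 = p → ∀ y ∈ matchingChains (S \ {s}) q,
      f (edgeGen b s * (edgeGen c a * y)) = 0)
    (h9 : ∀ s ∈ S, ∀ q, q + 2 = p → ∀ y ∈ matchingChains (S \ {s}) q,
      f (edgeGen c s * (edgeGen a b * y)) = 0)
    (h10 : ∀ s ∈ S, ∀ t ∈ S, s ≠ t → ∀ q, q + 2 = p → ∀ y ∈ matchingChains (S \ {s, t}) q,
      f (edgeGen a s * (edgeGen b t * y)) = 0)
    (h11 : ∀ s ∈ S, ∀ t ∈ S, s ≠ t → ∀ q, q + 2 = p → ∀ y ∈ matchingChains (S \ {s, t}) q,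
      f (edgeGen b s * (edgeGen c t * y)) = 0)
    (h12 : ∀ s ∈ S, ∀ t ∈ S, s ≠ t → ∀ q, q + 2 = p → ∀ y ∈ matchingChains (S \ {s, t}) q,
      f (edgeGen c s * (edgeGen a t * y)) = 0)
    (h13 : ∀ s ∈ S, ∀ t ∈ S, ∀ u ∈ S, s ≠ t → s ≠ u → t ≠ u → ∀ q, q + 3 = p →
      ∀ y ∈ matchingChains (S \ {s, t, u}) q,
      f (edgeGen a s * (edgeGen b t * (edgeGen c u * y))) = 0) :
    ∀ w ∈ matchingChains (insert a (insert b (insert c S))) p, f w = 0 := by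
  refine cochain_eq_zero_of_vertex f
    (cochain_eq_zero_of_two_vertices hc hbc f h0 h1 h5 h6 h11) ?_
  intro s hs q hq y hy
  -- The partner of a is b, c or a vertex of S. The hypotheses are stated in the cyclic order of a,
  -- b, c, so some of them apply only after a swap of edges.
  rcases Finset.mem_insert.1 hs with rfl | hs
  · refine cochain_eq_zero_of_vertex (S := S) (a := c) (p := q)
      (f ∘ₗ LinearMap.mulLeft ℤ (edgeGen a s)) (fun y hy => h3 q hq y hy) ?_ y
      (matchingChains_mono (by grind) _ hy)
    intro u hu r hr y hy
    simpa [edgeGen_mul_left_swap c u a s] using h9 u hu r (by omega) y hy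
  rcases Finset.mem_insert.1 hs with rfl | hs
  · refine cochain_eq_zero_of_vertex (S := S) (a := b) (p := q)
      (f ∘ₗ LinearMap.mulLeft ℤ (edgeGen a s)) (fun y hy => ?_) ?_ y
      (matchingChains_mono (by grind) _ hy)
    · simpa [edgeGen_comm a s] using h2 q hq y hy
    intro u hu r hr y hy
    simpa [edgeGen_mul_left_swap b u s a, edgeGen_comm a s] using h8 u hu r (by omega) y hy
  · refine cochain_eq_zero_of_two_vertices (S := S \ {s}) (b := b) (c := c) (p := q) (by grind) hbc
      (f ∘ₗ LinearMap.mulLeft ℤ (edgeGen a s)) (fun y hy => h4 s hs q hq y hy) ?_ ?_ ?_ ?_ y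
      (matchingChains_mono (by grind) _ hy)
    · intro r hr y hy
      exact h7 s hs r (by omega) y hy
    · intro u hu r hr y hy
      exact h10 s hs u (by grind) (by grind) r (by omega) y (matchingChains_mono (by grind) _ hy)
    · intro u hu r hr y hy
      have := h12 u (by grind) s hs (by grind) r (by omega) y
        (matchingChains_mono (by grind) _ hy)
      simpa [edgeGen_mul_left_swap c u a s] using this
    · intro u hu v hv huv r hr y hy
      exact h13 s hs u (by grind) v (by grind) (by grind) (by grind) huv r (by omega) y
        (matchingChains_mono (by grind) _ hy)

/-- The extension pattern of a cochain `f` on `S` by a triangle `abc`: a cochain on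
`S ∪ {a, b, c}` that is `f` times a `0`-cochain of the triangle with values `α`, `α - 1`, `α + 1`
on the edges `bc`, `ca`, `ab`, corrected on the edges between the triangle and `S`. -/
structure TriangleExtension (S : Finset V) (a b c : V) (α : ZMod 3) (f : MatchingCochain V)
    (h : V → V → V → MatchingCochain V) (F : MatchingCochain V) : Prop where
  base : ∀ p, ∀ y ∈ matchingChains S p, F y = 0
  bc : ∀ p, ∀ y ∈ matchingChains S p, F (edgeGen b c * y) = α * f y
  ca : ∀ p, ∀ y ∈ matchingChains S p, F (edgeGen c a * y) = (α - 1) * f y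
  ab : ∀ p, ∀ y ∈ matchingChains S p, F (edgeGen a b * y) = (α + 1) * f y
  a1 : ∀ s ∈ S, ∀ p, ∀ y ∈ matchingChains (S \ {s}) p, F (edgeGen a s * y) = α * f y
  b1 : ∀ s ∈ S, ∀ p, ∀ y ∈ matchingChains (S \ {s}) p, F (edgeGen b s * y) = (α - 1) * f y
  c1 : ∀ s ∈ S, ∀ p, ∀ y ∈ matchingChains (S \ {s}) p, F (edgeGen c s * y) = (α + 1) * f y
  a_bc : ∀ s ∈ S, ∀ p, ∀ y ∈ matchingChains (S \ {s}) p,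
    F (edgeGen a s * (edgeGen b c * y)) = 0
  b_ca : ∀ s ∈ S, ∀ p, ∀ y ∈ matchingChains (S \ {s}) p,
    F (edgeGen b s * (edgeGen c a * y)) = 0
  c_ab : ∀ s ∈ S, ∀ p, ∀ y ∈ matchingChains (S \ {s}) p,
    F (edgeGen c s * (edgeGen a b * y)) = 0
  ab2 : ∀ s ∈ S, ∀ t ∈ S, s ≠ t → ∀ p, ∀ y ∈ matchingChains (S \ {s, t}) p,
    F (edgeGen a s * (edgeGen b t * y)) = f (edgeGen s t * y)
  bc2 : ∀ s ∈ S, ∀ t ∈ S, s ≠ t → ∀ p, ∀ y ∈ matchingChains (S \ {s, t}) p,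
    F (edgeGen b s * (edgeGen c t * y)) = f (edgeGen s t * y)
  ca2 : ∀ s ∈ S, ∀ t ∈ S, s ≠ t → ∀ p, ∀ y ∈ matchingChains (S \ {s, t}) p,
    F (edgeGen c s * (edgeGen a t * y)) = f (edgeGen s t * y)
  abc3 : ∀ s ∈ S, ∀ t ∈ S, ∀ u ∈ S, s ≠ t → s ≠ u → t ≠ u → ∀ p,
    ∀ y ∈ matchingChains (S \ {s, t, u}) p,
    F (edgeGen a s * (edgeGen b t * (edgeGen c u * y))) = h s t u y

theorem three_eq_zero_zmod : (3 : ZMod 3) = 0 := by decide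

/-- The values α, α - 1, α + 1 are permuted cyclically when α drops by 1, as α - 2 = α + 1 modulo 3.
Keeping α general lets every fact proved at a be transported to b and c. -/
theorem TriangleExtension.rotate {S : Finset V} {a b c : V} {α : ZMod 3} {f F : MatchingCochain V}
    {h : V → V → V → MatchingCochain V} (H : TriangleExtension S a b c α f h F) :
    TriangleExtension S b c a (α - 1) f (fun t u s => h s t u) F where
  base := H.base
  bc := H.ca
  ca p y hy := by
    linear_combination H.ab p y hy + f y * three_eq_zero_zmod
  ab p y hy := by linear_combination H.bc p y hy
  a1 := H.b1
  b1 s hs p y hy := by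
    linear_combination H.c1 s hs p y hy + f y * three_eq_zero_zmod
  c1 s hs p y hy := by linear_combination H.a1 s hs p y hy
  a_bc := H.b_ca
  b_ca := H.c_ab
  c_ab := H.a_bc
  ab2 := H.bc2
  bc2 := H.ca2
  ca2 := H.ab2
  -- A cyclic permutation of three edges is even, so no sign appears.
  abc3 t ht u hu s hs htu hts hus p y hy := by
    rw [← H.abc3 s hs t ht u hu hts.symm hus.symm htu p y (matchingChains_mono (by grind) _ hy),
      edgeGen_mul_left_swap c u a s, mul_neg, edgeGen_mul_left_swap b t a s, neg_neg]

-- The prescriptions concern different ways of covering a, b, c, so they never conflict. The cochain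
-- is layered by the partner of a: `G0` for none, `Gb` and `Gc` for b and c, `G s` for s in S.
set_option maxHeartbeats 1000000 in
theorem exists_triangleExtension {S : Finset V} {a b c : V} (ha : a ∉ S) (hb : b ∉ S)
    (hc : c ∉ S) (hab : a ≠ b) (hac : a ≠ c) (hbc : b ≠ c) (α : ZMod 3) (f : MatchingCochain V)
    (h : V → V → V → MatchingCochain V) : ∃ F, TriangleExtension S a b c α f h F := by
  have hbs : ∀ t ∈ S, b ≠ t := fun t ht h => hb (h ▸ ht)
  have hcs : ∀ t ∈ S, c ≠ t := fun t ht h => hc (h ▸ ht)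
  have mem_bc : ∀ (R : Finset V), R ⊆ S → ∀ {p : ℕ} {y : ExteriorAlgebra ℤ (Sym2 V →₀ ℤ)},
      y ∈ matchingChains R p → edgeGen b c * y ∈ matchingChains (insert b (insert c R)) (p + 1) :=
    fun R hR p y hy => edgeGen_mul_mem hy (by simp) (by simp) hbc (by grind)
  have mem_b : ∀ (R : Finset V), R ⊆ S → ∀ t ∈ R, ∀ {p : ℕ} {y : ExteriorAlgebra ℤ (Sym2 V →₀ ℤ)},
      y ∈ matchingChains (R \ {t}) p → edgeGen b t * y ∈ matchingChains (insert b R) (p + 1) :=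
    fun R hR t ht p y hy =>
      edgeGen_mul_mem hy (by simp) (by simp [ht]) (hbs t (hR ht)) (by grind)
  have mem_c : ∀ (R : Finset V), R ⊆ S → ∀ t ∈ R, ∀ {p : ℕ} {y : ExteriorAlgebra ℤ (Sym2 V →₀ ℤ)},
      y ∈ matchingChains (R \ {t}) p → edgeGen c t * y ∈ matchingChains (insert c R) (p + 1) :=
    fun R hR t ht p y hy =>
      edgeGen_mul_mem hy (by simp) (by simp [ht]) (hcs t (hR ht)) (by grind)
  have mem_b_c : ∀ (R : Finset V), R ⊆ S → ∀ t ∈ R, ∀ u ∈ R, t ≠ u → ∀ {p : ℕ}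
      {y : ExteriorAlgebra ℤ (Sym2 V →₀ ℤ)}, y ∈ matchingChains (R \ {t, u}) p →
      edgeGen b t * (edgeGen c u * y) ∈ matchingChains (insert b (insert c R)) (p + 2) := by
    intro R hR t ht u hu htu p y hy
    have h1 := mem_c (R \ {t}) (Finset.sdiff_subset.trans hR) u (by grind)
      (matchingChains_mono (by grind) _ hy)
    exact edgeGen_mul_mem h1 (by simp) (by simp [ht]) (hbs t (hR ht)) (by grind)
  have hsS : ∀ s : V, S \ {s} ⊆ S := fun s => Finset.sdiff_subset
  have hS2 : S ⊆ insert b (insert c S) :=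
    (Finset.subset_insert _ _).trans (Finset.subset_insert _ _)
  have hmem : ∀ {s t : V}, s ∈ S → t ∈ S → s ≠ t → t ∈ S \ {s} := by grind
  have hyy : ∀ (s t : V) {p : ℕ} {y : ExteriorAlgebra ℤ (Sym2 V →₀ ℤ)},
      y ∈ matchingChains (S \ {s, t}) p → y ∈ matchingChains ((S \ {s}) \ {t}) p := by
    intro s t p y hy
    rwa [sdiff_sdiff_left, Finset.sup_eq_union, ← Finset.insert_eq]
  let M : V → V → MatchingCochain V := fun s t => f ∘ₗ LinearMap.mulLeft ℤ (edgeGen s t)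
  obtain ⟨G0, g0, g1, g2, g3, g4⟩ := exists_cochain_two_vertices hb hc hbc 0 (α • f)
    (fun _ => (α - 1) • f) (fun _ => (α + 1) • f) M
  obtain ⟨Gb, gb0, gb1⟩ := exists_cochain_vertex hc ((α + 1) • f) (fun _ => 0)
  obtain ⟨Gc, gc0, gc1⟩ := exists_cochain_vertex hb ((α - 1) • f) (fun _ => 0)
  -- The minus sign arises because this layer has the edge at a in front, whereas `ca2` has the edge
  -- at c in front.
  have hex : ∀ s : V, _ := fun s => exists_cochain_two_vertices (S := S \ {s}) (b := b) (c := c)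
    (by simp [hb]) (by simp [hc]) hbc (α • f) 0 (fun t => M s t) (fun t => -M t s) (fun t u => h s t u)
  choose G e0 e1 e2 e3 e4 using hex
  obtain ⟨F, hF, hF'⟩ := exists_cochain_vertex (S := insert b (insert c S)) (a := a) (by grind) G0
    (fun u => if u = b then Gb else if u = c then Gc else G u)
  have hFb : ∀ p, ∀ y ∈ matchingChains (insert c S) p, F (edgeGen a b * y) = Gb y := by
    intro p y hy
    rw [hF' b (by grind) p y (matchingChains_mono (by grind) _ hy), if_pos rfl]
  have hFc : ∀ p, ∀ y ∈ matchingChains (insert b S) p, F (edgeGen a c * y) = Gc y := by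
    intro p y hy
    rw [hF' c (by grind) p y (matchingChains_mono (by grind) _ hy), if_neg hbc.symm, if_pos rfl]
  have hFs : ∀ s ∈ S, ∀ p, ∀ y ∈ matchingChains (insert b (insert c (S \ {s}))) p,
      F (edgeGen a s * y) = G s y := by
    intro s hs p y hy
    rw [hF' s (by grind) p y (matchingChains_mono (by grind) _ hy), if_neg (by grind),
      if_neg (by grind)]
  refine ⟨F, ?_, ?_, ?_, ?_, ?_, ?_, ?_, ?_, ?_, ?_, ?_, ?_, ?_, ?_⟩
  · intro p y hy
    rw [hF p y (matchingChains_mono hS2 _ hy), g0 p y hy, LinearMap.zero_apply]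
  · intro p y hy
    rw [hF _ _ (mem_bc S le_rfl hy), g1 p y hy]
    rfl
  · intro p y hy
    rw [edgeGen_comm, hFc p y (matchingChains_mono (Finset.subset_insert _ _) _ hy), gc0 p y hy]
    rfl
  · intro p y hy
    rw [hFb p y (matchingChains_mono (Finset.subset_insert _ _) _ hy), gb0 p y hy]
    rfl
  · intro s hs p y hy
    rw [hFs s hs p y (matchingChains_mono
      ((Finset.subset_insert _ _).trans (Finset.subset_insert _ _)) _ hy), e0 s p y hy]
    rfl
  · intro s hs p y hy
    rw [hF _ _ (matchingChains_mono
      (Finset.insert_subset_insert _ (Finset.subset_insert _ _)) _ (mem_b S le_rfl s hs hy)), g2 s hs p y hy]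
    rfl
  · intro s hs p y hy
    rw [hF _ _ (matchingChains_mono (Finset.subset_insert _ _) _
      (mem_c S le_rfl s hs hy)), g3 s hs p y hy]
    rfl
  · intro s hs p y hy
    rw [hFs s hs _ _ (mem_bc _ (hsS s) hy),
      e1 s p y hy, LinearMap.zero_apply]
  · intro s hs p y hy
    rw [edgeGen_comm c a, edgeGen_mul_left_swap, map_neg,
      hFc _ _ (mem_b S le_rfl s hs hy), gc1 s hs p y hy]
    simp
  · intro s hs p y hy
    rw [edgeGen_mul_left_swap, map_neg,
      hFb _ _ (mem_c S le_rfl s hs hy), gb1 s hs p y hy]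
    simp
  · intro s hs t ht hst p y hy
    rw [hFs s hs _ _ (matchingChains_mono
      (Finset.insert_subset_insert _ (Finset.subset_insert _ _)) _
      (mem_b _ (hsS s) t (hmem hs ht hst) (hyy s t hy))),
      e2 s t (hmem hs ht hst) p y (hyy s t hy)]
    rfl
  · intro s hs t ht hst p y hy
    rw [hF _ _ (mem_b_c S le_rfl s hs t ht hst hy), g4 s hs t ht hst p y hy]
    rfl
  · intro s hs t ht hst p y hy
    have hy' := hyy t s (Finset.pair_comm s t ▸ hy)
    rw [edgeGen_mul_left_swap, map_neg,
      hFs t ht _ _ (matchingChains_mono (Finset.subset_insert _ _) _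
        (mem_c _ (hsS t) s (hmem ht hs hst.symm) hy')), e3 t s (hmem ht hs hst.symm) p y hy']
    simp [M]
  · intro s hs t ht u hu hst hsu htu p y hy
    have hy' : y ∈ matchingChains ((S \ {s}) \ {t, u}) p := by
      rwa [sdiff_sdiff_left, Finset.sup_eq_union, ← Finset.insert_eq]
    rw [hFs s hs _ _ (mem_b_c _ (hsS s) t (hmem hs ht hst) u (hmem hs hu hsu) htu hy'),
      e4 s t (hmem hs ht hst) u (hmem hs hu hsu) htu p y hy']

end Vertices

/-! ### Vanishing of low-degree cohomology modulo 3 -/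

section Connectivity

variable {V : Type*} [DecidableEq V]

set_option maxHeartbeats 1000000 in
/-- Cocycles in low degree are coboundaries: the matching complex on `S` has no cohomology modulo
`3` on matchings with `p` edges if `3 * p + 2 ≤ #S`. -/
theorem exists_eq_comp_simplicialBoundary (p : ℕ) (S : Finset V) (f : MatchingCochain V)
    (hS : 3 * p + 2 ≤ S.card)
    (hf : ∀ y ∈ matchingChains S (p + 1), f (simplicialBoundary (Sym2 V) y) = 0) :
    ∃ g : MatchingCochain V, ∀ y ∈ matchingChains S p, f y = g (simplicialBoundary (Sym2 V) y) := by
  induction p using Nat.strong_induction_on generalizing S f with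
  | _ p ih =>
  obtain ⟨b, hbS, c, hcS, hbc⟩ := Finset.one_lt_card.1 (show 1 < S.card by omega)
  obtain ⟨T, rfl, hb, hc⟩ : ∃ T, S = insert b (insert c T) ∧ b ∉ T ∧ c ∉ T :=
    ⟨S \ {b, c}, by grind, by grind, by grind⟩
  have hT : 3 * p ≤ T.card := by
    rw [Finset.card_insert_of_notMem (by grind), Finset.card_insert_of_notMem hc] at hS
    omega
  clear hbS hcS hS
  -- The cocycle may be changed by coboundaries. Three such changes kill it successively on
  -- matchings containing bc, on those covering exactly one of b and c, and on those joining b and c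
  -- to two vertices of T.
  have hadd : ∀ f₁ g₁ : MatchingCochain V,
      (∃ g : MatchingCochain V, ∀ y ∈ matchingChains (insert b (insert c T)) p,
        (f₁ - g₁ ∘ₗ simplicialBoundary (Sym2 V)) y = g (simplicialBoundary (Sym2 V) y)) →
      ∃ g : MatchingCochain V, ∀ y ∈ matchingChains (insert b (insert c T)) p,
        f₁ y = g (simplicialBoundary (Sym2 V) y) := by
    rintro f₁ g₁ ⟨g, hg⟩
    refine ⟨g + g₁, fun y hy => ?_⟩
    have := hg y hy
    simp only [LinearMap.sub_apply, LinearMap.comp_apply, LinearMap.add_apply] at this ⊢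
    linear_combination this
  have hcoc : ∀ f₁ g₁ : MatchingCochain V,
      (∀ y ∈ matchingChains (insert b (insert c T)) (p + 1),
        f₁ (simplicialBoundary (Sym2 V) y) = 0) →
      ∀ y ∈ matchingChains (insert b (insert c T)) (p + 1),
        (f₁ - g₁ ∘ₗ simplicialBoundary (Sym2 V)) (simplicialBoundary (Sym2 V) y) = 0 := by
    intro f₁ g₁ h y hy
    have h2 : simplicialBoundary (Sym2 V) (simplicialBoundary (Sym2 V) y) = 0 :=
      CliffordAlgebra.contractLeft_contractLeft _ _
    simp [h y hy, h2]
  -- On T, g₁ is the contraction of f with bc, and g₁ vanishes on matchings containing bc. Hence its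
  -- coboundary agrees with f on the matchings bc * y.
  obtain ⟨g₁, a0, a1, -, -, -⟩ := exists_cochain_two_vertices hb hc hbc
    (f ∘ₗ LinearMap.mulLeft ℤ (edgeGen b c)) 0 0 0 0
  refine hadd f g₁ ?_
  have k1 : ∀ q, q + 1 = p → ∀ y ∈ matchingChains T q,
      (f - g₁ ∘ₗ simplicialBoundary (Sym2 V)) (edgeGen b c * y) = 0 := by
    intro q hq y hy
    simp [simplicialBoundary_edgeGen_mul, a0 q y hy, a1 _ _ (simplicialBoundary_mem hy)]
  have hf1 := hcoc f g₁ hf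
  generalize f - g₁ ∘ₗ simplicialBoundary (Sym2 V) = f₁ at k1 hf1 ⊢
  clear hf a0 a1 g₁ f
  -- Apply the cocycle condition to bc * y: the term bc * ∂y is already killed.
  have k0 : ∀ y ∈ matchingChains T p, f₁ y = 0 := by
    intro y hy
    have := hf1 (edgeGen b c * y)
      (edgeGen_mul_mem hy (by grind) (by grind) (by grind) (by grind))
    rw [simplicialBoundary_edgeGen_mul, map_sub] at this
    cases p with
    | zero =>
      have h0 : simplicialBoundary (Sym2 V) y = 0 := by
        have : matchingChains T 0 ≤ LinearMap.ker (simplicialBoundary (Sym2 V)) := by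
          refine Submodule.span_le.2 fun w hw => ?_
          cases hw
          exact simplicialBoundary_one
        exact this hy
      simpa [h0] using this
    | succ p =>
      rw [k1 p rfl _ (simplicialBoundary_mem_of_succ hy), sub_zero] at this
      exact this
  have hv : ∀ x ∈ ({b, c} : Finset V), ∀ u ∈ T, ∃ g : MatchingCochain V, ∀ q, q + 1 = p →
      ∀ y ∈ matchingChains (T \ {u}) q, f₁ (edgeGen x u * y) = g (simplicialBoundary (Sym2 V) y) := by
    intro x hx u hu
    cases p with
    | zero => exact ⟨0, by simp⟩
    | succ p =>
      -- T has at least 3(p + 1) vertices here, so removing u leaves 3p + 2, exactly the bound for p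
      -- edges.
      obtain ⟨g, hg⟩ := ih p (by omega) (T \ {u}) (f₁ ∘ₗ LinearMap.mulLeft ℤ (edgeGen x u))
        (by
          have := Finset.le_card_sdiff {u} T
          rw [Finset.card_singleton] at this
          omega) (by
        intro y hy
        have := hf1 (edgeGen x u * y)
          (edgeGen_mul_mem hy (by grind) (by grind) (by grind) (by grind))
        rw [simplicialBoundary_edgeGen_mul, map_sub,
          k0 y (matchingChains_mono Finset.sdiff_subset _ hy), zero_sub, neg_eq_zero] at this
        exact this)
      refine ⟨g, fun q hq y hy => ?_⟩
      obtain rfl : q = p := by omega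
      exact hg y hy
  choose! G hG using hv
  -- The signs compensate the one in ∂(e * y) = y - e * ∂y.
  obtain ⟨g₂, a0, a1, a2, a3, -⟩ := exists_cochain_two_vertices hb hc hbc
    0 0 (fun u => -G b u) (fun u => -G c u) 0
  refine hadd f₁ g₂ ?_
  have l0 : ∀ y ∈ matchingChains T p,
      (f₁ - g₂ ∘ₗ simplicialBoundary (Sym2 V)) y = 0 := by
    intro y hy
    simp [k0 y hy, a0 _ _ (simplicialBoundary_mem hy)]
  have l1 : ∀ q, q + 1 = p → ∀ y ∈ matchingChains T q,
      (f₁ - g₂ ∘ₗ simplicialBoundary (Sym2 V)) (edgeGen b c * y) = 0 := by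
    intro q hq y hy
    simp [simplicialBoundary_edgeGen_mul, k1 q hq y hy, a0 q y hy,
      a1 _ _ (simplicialBoundary_mem hy)]
  have l2 : ∀ u ∈ T, ∀ q, q + 1 = p → ∀ y ∈ matchingChains (T \ {u}) q,
      (f₁ - g₂ ∘ₗ simplicialBoundary (Sym2 V)) (edgeGen b u * y) = 0 := by
    intro u hu q hq y hy
    simp [simplicialBoundary_edgeGen_mul, hG b (by simp) u hu q hq y hy,
      a0 q y (matchingChains_mono Finset.sdiff_subset _ hy),
      a2 u hu _ _ (simplicialBoundary_mem hy)]
  have l3 : ∀ u ∈ T, ∀ q, q + 1 = p → ∀ y ∈ matchingChains (T \ {u}) q,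
      (f₁ - g₂ ∘ₗ simplicialBoundary (Sym2 V)) (edgeGen c u * y) = 0 := by
    intro u hu q hq y hy
    simp [simplicialBoundary_edgeGen_mul, hG c (by simp) u hu q hq y hy,
      a0 q y (matchingChains_mono Finset.sdiff_subset _ hy),
      a3 u hu _ _ (simplicialBoundary_mem hy)]
  have hf2 := hcoc f₁ g₂ hf1
  generalize f₁ - g₂ ∘ₗ simplicialBoundary (Sym2 V) = f₂ at l0 l1 l2 l3 hf2 ⊢
  clear hf1 k0 k1 hG a0 a1 a2 a3 g₂ f₁ G
  have hw : ∀ u ∈ T, ∀ v ∈ T, u ≠ v → ∃ g : MatchingCochain V, ∀ q, q + 2 = p →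
      ∀ y ∈ matchingChains (T \ {u, v}) q,
      f₂ (edgeGen b u * (edgeGen c v * y)) = g (simplicialBoundary (Sym2 V) y) := by
    intro u hu v hv huv
    by_cases hp : ∃ q, q + 2 = p
    · obtain ⟨q, rfl⟩ := hp
      obtain ⟨g, hg⟩ := ih q (by omega) (T \ {u, v})
        (f₂ ∘ₗ LinearMap.mulLeft ℤ (edgeGen b u) ∘ₗ LinearMap.mulLeft ℤ (edgeGen c v))
        (by
          have := Finset.le_card_sdiff {u, v} T
          rw [Finset.card_pair huv] at this
          omega) (by
        intro y hy
        have := hf2 (edgeGen b u * (edgeGen c v * y))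
          (edgeGen_mul_mem (T := insert c (T \ {u}))
            (edgeGen_mul_mem hy (by grind) (by grind) (by grind) (by grind))
            (by grind) (by grind) (by grind) (by grind))
        rw [simplicialBoundary_edgeGen_mul, simplicialBoundary_edgeGen_mul, mul_sub, map_sub,
          map_sub, l2 u hu (q + 1) rfl y (matchingChains_mono (by grind) _ hy),
          l3 v hv (q + 1) rfl y (matchingChains_mono (by grind) _ hy)] at this
        simpa using this)
      refine ⟨g, fun r hr y hy => ?_⟩
      obtain rfl : r = q := by omega
      exact hg y hy
    · exact ⟨0, fun q hq => (hp ⟨q, hq⟩).elim⟩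
  choose! G hG using hw
  -- Moving ∂ past two edges costs no sign, so `G` enters unchanged.
  obtain ⟨g₃, a0, a1, a2, a3, a4⟩ := exists_cochain_two_vertices hb hc hbc 0 0 0 0 G
  refine ⟨g₃, ?_⟩
  have := cochain_eq_zero_of_two_vertices hc hbc (p := p)
    (f₂ - g₃ ∘ₗ simplicialBoundary (Sym2 V)) ?_ ?_ ?_ ?_ ?_
  · exact fun y hy => sub_eq_zero.1 (this y hy)
  · intro y hy
    simp [l0 y hy, a0 _ _ (simplicialBoundary_mem hy)]
  · intro q hq y hy
    simp [simplicialBoundary_edgeGen_mul, l1 q hq y hy, a0 q y hy,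
      a1 _ _ (simplicialBoundary_mem hy)]
  · intro u hu q hq y hy
    simp [simplicialBoundary_edgeGen_mul, l2 u hu q hq y hy,
      a0 q y (matchingChains_mono Finset.sdiff_subset _ hy),
      a2 u hu _ _ (simplicialBoundary_mem hy)]
  · intro u hu q hq y hy
    simp [simplicialBoundary_edgeGen_mul, l3 u hu q hq y hy,
      a0 q y (matchingChains_mono Finset.sdiff_subset _ hy),
      a3 u hu _ _ (simplicialBoundary_mem hy)]
  · intro u hu v hv huv q hq y hy
    simp [simplicialBoundary_edgeGen_mul, mul_sub, hG u hu v hv huv q hq y hy,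
      a2 u hu _ _ (matchingChains_mono (by grind) _ hy),
      a3 v hv _ _ (matchingChains_mono (by grind) _ hy),
      a4 u hu v hv huv _ _ (simplicialBoundary_mem hy)]

end Connectivity

/-! ### Triangular cocycles -/

/-- The sum of the three edges of a triangle. -/
noncomputable def triangleSum {V : Type*} (s t u : V) : ExteriorAlgebra ℤ (Sym2 V →₀ ℤ) :=
  edgeGen s t + edgeGen t u + edgeGen u s

/-- The cochain `f` on matchings with `k` edges inside `S` becomes a coboundary when it is contracted
with the triangle `stu`. -/
def ContractsTriangle {V : Type*} [DecidableEq V] (S : Finset V) (k : ℕ) (f : MatchingCochain V)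
    (s t u : V) : Prop :=
  ∃ h : MatchingCochain V, ∀ q, q + 1 = k → ∀ y ∈ matchingChains (S \ {s, t, u}) q,
    f (triangleSum s t u * y) = h (simplicialBoundary (Sym2 V) y)

/-- A cocycle modulo `3` on matchings with `k` edges inside `S`, whose contraction with every
triangle is a coboundary. -/
structure IsTriangularCocycle {V : Type*} [DecidableEq V] (S : Finset V) (k : ℕ)
    (f : MatchingCochain V) : Prop where
  card : 3 * k ≤ S.card
  cocycle : ∀ y ∈ matchingChains S (k + 1), f (simplicialBoundary (Sym2 V) y) = 0
  triangle : ∀ s ∈ S, ∀ t ∈ S, ∀ u ∈ S, s ≠ t → s ≠ u → t ≠ u → ContractsTriangle S k f s t u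

/-! ### The extension is a cocycle, and its contraction with triangles that meet abc -/

section Triangle

variable {V : Type*}

theorem triangleSum_rotate (s t u : V) : triangleSum t u s = triangleSum s t u := by
  simp only [triangleSum]
  abel

theorem triangleSum_swap (s t u : V) : triangleSum t s u = triangleSum s t u := by
  simp only [triangleSum, edgeGen_comm t s, edgeGen_comm s u, edgeGen_comm u t]
  abel

theorem triangleSum_mul_edgeGen_mul (s t u a b : V) (y : ExteriorAlgebra ℤ (Sym2 V →₀ ℤ)) :
    triangleSum s t u * (edgeGen a b * y) = -(edgeGen a b * (triangleSum s t u * y)) := by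
  simp only [triangleSum, add_mul, mul_add, edgeGen_mul_left_swap _ _ a b]
  abel

variable [DecidableEq V]

theorem triangleSum_mul_mem {S T : Finset V} {p : ℕ} {y : ExteriorAlgebra ℤ (Sym2 V →₀ ℤ)}
    {s t u : V} (hy : y ∈ matchingChains T p) (hs : s ∈ S) (ht : t ∈ S) (hu : u ∈ S) (hst : s ≠ t)
    (hsu : s ≠ u) (htu : t ≠ u) (hT : T ⊆ S \ {s, t, u}) :
    triangleSum s t u * y ∈ matchingChains S (p + 1) := by
  simp only [triangleSum, add_mul]
  refine add_mem (add_mem (edgeGen_mul_mem hy hs ht hst (hT.trans ?_))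
    (edgeGen_mul_mem hy ht hu htu (hT.trans ?_)))
    (edgeGen_mul_mem hy hu hs hsu.symm (hT.trans ?_)) <;>
  exact Finset.sdiff_subset_sdiff le_rfl (by simp [Finset.insert_subset_iff])

theorem ContractsTriangle.rotate {S : Finset V} {k : ℕ} {f : MatchingCochain V} {s t u : V}
    (H : ContractsTriangle S k f s t u) : ContractsTriangle S k f t u s := by
  obtain ⟨h, hh⟩ := H
  refine ⟨h, fun q hq y hy => ?_⟩
  rw [triangleSum_rotate, hh q hq y (matchingChains_mono (by grind) _ hy)]

theorem ContractsTriangle.swap {S : Finset V} {k : ℕ} {f : MatchingCochain V} {s t u : V}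
    (H : ContractsTriangle S k f s t u) : ContractsTriangle S k f t s u := by
  obtain ⟨h, hh⟩ := H
  refine ⟨h, fun q hq y hy => ?_⟩
  rw [triangleSum_swap, hh q hq y (matchingChains_mono (by grind) _ hy)]

variable {S : Finset V} {a b c : V} {α : ZMod 3} {f F : MatchingCochain V}
  {h : V → V → V → MatchingCochain V} {k : ℕ}

theorem cochain_eq_of_cocycle (hf : ∀ y ∈ matchingChains S (k + 1),
    f (simplicialBoundary (Sym2 V) y) = 0) {s t : V} (hs : s ∈ S) (ht : t ∈ S) (hst : s ≠ t)
    {y : ExteriorAlgebra ℤ (Sym2 V →₀ ℤ)} (hy : y ∈ matchingChains (S \ {s, t}) k) :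
    f (edgeGen s t * simplicialBoundary (Sym2 V) y) = f y := by
  have := hf _ (edgeGen_mul_mem hy hs ht hst le_rfl)
  rw [simplicialBoundary_edgeGen_mul, map_sub] at this
  linear_combination -this

/-- With two vertices joined to s, t in S, the two one-edge terms differ by a multiple of f y that
cancels f(st * ∂y). With all three joined to s, t, u, the two-edge terms add up to the contraction
of f with stu, and `h s t u` must be a primitive of it. -/
theorem TriangleExtension.cocycle (H : TriangleExtension S a b c α f h F) (hb : b ∉ S) (hc : c ∉ S)
    (hab : a ≠ b) (hac : a ≠ c) (hbc : b ≠ c)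
    (hf : ∀ y ∈ matchingChains S (k + 1), f (simplicialBoundary (Sym2 V) y) = 0)
    (hh : ∀ s ∈ S, ∀ t ∈ S, ∀ u ∈ S, s ≠ t → s ≠ u → t ≠ u → ∀ q, q + 1 = k →
      ∀ y ∈ matchingChains (S \ {s, t, u}) q,
      f (triangleSum s t u * y) = h s t u (simplicialBoundary (Sym2 V) y)) :
    ∀ w ∈ matchingChains (insert a (insert b (insert c S))) (k + 2),
      F (simplicialBoundary (Sym2 V) w) = 0 := by
  have hd : ∀ s ∈ S, ∀ y ∈ matchingChains (S \ {s}) (k + 1),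
      f (simplicialBoundary (Sym2 V) y) = 0 := fun s _ y hy =>
    hf y (matchingChains_mono Finset.sdiff_subset _ hy)
  have hm : ∀ (s : V) {p : ℕ} {y : ExteriorAlgebra ℤ (Sym2 V →₀ ℤ)},
      y ∈ matchingChains (S \ {s}) p → y ∈ matchingChains S p := fun s p y hy =>
    matchingChains_mono Finset.sdiff_subset _ hy
  have hm1 : ∀ (s t : V) {p : ℕ} {y : ExteriorAlgebra ℤ (Sym2 V →₀ ℤ)},
      y ∈ matchingChains (S \ {s, t}) p → y ∈ matchingChains (S \ {s}) p := fun s t p y hy =>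
    matchingChains_mono (by grind) _ hy
  have hm2 : ∀ (s t : V) {p : ℕ} {y : ExteriorAlgebra ℤ (Sym2 V →₀ ℤ)},
      y ∈ matchingChains (S \ {s, t}) p → y ∈ matchingChains (S \ {t}) p := fun s t p y hy =>
    matchingChains_mono (by grind) _ hy
  refine cochain_eq_zero_of_three_vertices hb hc hab hac hbc
    (F ∘ₗ simplicialBoundary (Sym2 V)) ?_ ?_ ?_ ?_ ?_ ?_ ?_ ?_ ?_ ?_ ?_ ?_ ?_ ?_
  · intro y hy
    exact H.base _ _ (simplicialBoundary_mem hy)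
  · intro q hq y hy
    obtain rfl : q = k + 1 := by omega
    simp [simplicialBoundary_edgeGen_mul, H.base _ _ hy, H.bc _ _ (simplicialBoundary_mem hy), hf y hy]
  · intro q hq y hy
    obtain rfl : q = k + 1 := by omega
    simp [simplicialBoundary_edgeGen_mul, H.base _ _ hy, H.ca _ _ (simplicialBoundary_mem hy), hf y hy]
  · intro q hq y hy
    obtain rfl : q = k + 1 := by omega
    simp [simplicialBoundary_edgeGen_mul, H.base _ _ hy, H.ab _ _ (simplicialBoundary_mem hy), hf y hy]
  · intro s hs q hq y hy
    obtain rfl : q = k + 1 := by omega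
    simp [simplicialBoundary_edgeGen_mul, H.base _ _ (hm s hy),
      H.a1 s hs _ _ (simplicialBoundary_mem hy), hd s hs y hy]
  · intro s hs q hq y hy
    obtain rfl : q = k + 1 := by omega
    simp [simplicialBoundary_edgeGen_mul, H.base _ _ (hm s hy),
      H.b1 s hs _ _ (simplicialBoundary_mem hy), hd s hs y hy]
  · intro s hs q hq y hy
    obtain rfl : q = k + 1 := by omega
    simp [simplicialBoundary_edgeGen_mul, H.base _ _ (hm s hy),
      H.c1 s hs _ _ (simplicialBoundary_mem hy), hd s hs y hy]
  · intro s hs q hq y hy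
    simp [simplicialBoundary_edgeGen_mul, mul_sub, H.bc _ _ (hm s hy), H.a1 s hs _ _ hy,
      H.a_bc s hs _ _ (simplicialBoundary_mem hy)]
  · intro s hs q hq y hy
    simp [simplicialBoundary_edgeGen_mul, mul_sub, H.ca _ _ (hm s hy), H.b1 s hs _ _ hy,
      H.b_ca s hs _ _ (simplicialBoundary_mem hy)]
  · intro s hs q hq y hy
    simp [simplicialBoundary_edgeGen_mul, mul_sub, H.ab _ _ (hm s hy), H.c1 s hs _ _ hy,
      H.c_ab s hs _ _ (simplicialBoundary_mem hy)]
  · intro s hs t ht hst q hq y hy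
    obtain rfl : q = k := by omega
    simp only [LinearMap.comp_apply, simplicialBoundary_edgeGen_mul, mul_sub, map_sub,
      H.b1 t ht _ _ (hm2 s t hy), H.a1 s hs _ _ (hm1 s t hy),
      H.ab2 s hs t ht hst _ _ (simplicialBoundary_mem hy), cochain_eq_of_cocycle hf hs ht hst hy]
    ring
  · intro s hs t ht hst q hq y hy
    obtain rfl : q = k := by omega
    simp only [LinearMap.comp_apply, simplicialBoundary_edgeGen_mul, mul_sub, map_sub,
      H.c1 t ht _ _ (hm2 s t hy), H.b1 s hs _ _ (hm1 s t hy),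
      H.bc2 s hs t ht hst _ _ (simplicialBoundary_mem hy), cochain_eq_of_cocycle hf hs ht hst hy]
    linear_combination f y * three_eq_zero_zmod
  · intro s hs t ht hst q hq y hy
    obtain rfl : q = k := by omega
    simp only [LinearMap.comp_apply, simplicialBoundary_edgeGen_mul, mul_sub, map_sub,
      H.a1 t ht _ _ (hm2 s t hy), H.c1 s hs _ _ (hm1 s t hy),
      H.ca2 s hs t ht hst _ _ (simplicialBoundary_mem hy), cochain_eq_of_cocycle hf hs ht hst hy]
    ring
  · intro s hs t ht u hu hst hsu htu q hq y hy
    have e := hh s hs t ht u hu hst hsu htu q (by omega) y hy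
    simp only [triangleSum, add_mul, map_add] at e
    have e1 := H.bc2 t ht u hu htu q y (matchingChains_mono (by grind) _ hy)
    have e2 := H.ca2 u hu s hs hsu.symm q y (matchingChains_mono (by grind) _ hy)
    have e3 := H.ab2 s hs t ht hst q y (matchingChains_mono (by grind) _ hy)
    simp only [LinearMap.comp_apply, simplicialBoundary_edgeGen_mul, mul_sub, map_sub,
      edgeGen_mul_left_swap a s c u, map_neg, e1, e2, e3,
      H.abc3 s hs t ht u hu hst hsu htu _ _ (simplicialBoundary_mem hy)]
    linear_combination e

/-- The three values add up to 3α = 0, so the contraction is zero on the nose. -/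
theorem TriangleExtension.contractsTriangle_triangle (H : TriangleExtension S a b c α f h F) :
    ContractsTriangle (insert a (insert b (insert c S))) (k + 1) F a b c := by
  refine ⟨0, fun q hq y hy => ?_⟩
  have hy' : y ∈ matchingChains S q := matchingChains_mono (by grind) _ hy
  simp only [triangleSum, add_mul, map_add, H.ab _ _ hy', H.bc _ _ hy', H.ca _ _ hy',
    LinearMap.zero_apply]
  linear_combination α * f y * three_eq_zero_zmod

/-- The contraction vanishes again: if c is uncovered the values add up to 3α, and if c is joined to
u the contributions of bs and sa are opposite. -/
theorem TriangleExtension.contractsTriangle_edge (H : TriangleExtension S a b c α f h F) {s : V} (hs : s ∈ S) :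
    ContractsTriangle (insert a (insert b (insert c S))) (k + 1) F a b s := by
  refine ⟨0, fun q hq y hy => ?_⟩
  refine cochain_eq_zero_of_vertex (S := S \ {s}) (a := c) (p := q)
    (F ∘ₗ LinearMap.mulLeft ℤ (triangleSum a b s)) ?_ ?_ y (matchingChains_mono (by grind) _ hy)
  · intro y hy
    have hy' : y ∈ matchingChains S q := matchingChains_mono Finset.sdiff_subset _ hy
    simp only [LinearMap.comp_apply, LinearMap.mulLeft_apply, triangleSum, add_mul, map_add,
      H.ab _ _ hy', H.b1 s hs _ _ hy, edgeGen_comm s a, H.a1 s hs _ _ hy]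
    linear_combination α * f y * three_eq_zero_zmod
  · intro u hu r hr y hy
    have hsu : s ≠ u := by grind
    have huS : u ∈ S := by grind
    have e1 := H.c_ab u huS r y (matchingChains_mono (by grind) _ hy)
    have e2 := H.bc2 s hs u huS hsu r y (matchingChains_mono (by grind) _ hy)
    have e3 := H.ca2 u huS s hs hsu.symm r y (matchingChains_mono (by grind) _ hy)
    simp only [LinearMap.comp_apply, LinearMap.mulLeft_apply, triangleSum, add_mul, map_add,
      edgeGen_mul_left_swap a b c u, map_neg, e1, e2, edgeGen_comm s a,
      edgeGen_mul_left_swap a s c u, e3, edgeGen_comm u s]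
    ring

/-- Supplies the primitive for the triangle ast on matchings with b joined to u and c to v. In suv +
tuv - stv - stu all edges cancel except 2uv - 2st; the cocycle relation of f on uv * st * y supplies
one more uv - st, and 3 = 0. So the left side is a cocycle, hence a coboundary. -/
theorem exists_quadrangle_cochain
    (hS : 3 * k ≤ S.card)
    (hf : ∀ y ∈ matchingChains S (k + 1), f (simplicialBoundary (Sym2 V) y) = 0)
    (hh : ∀ s ∈ S, ∀ t ∈ S, ∀ u ∈ S, s ≠ t → s ≠ u → t ≠ u → ∀ q, q + 1 = k →
      ∀ y ∈ matchingChains (S \ {s, t, u}) q,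
      f (triangleSum s t u * y) = h s t u (simplicialBoundary (Sym2 V) y))
    {s t : V} (hs : s ∈ S) (ht : t ∈ S) (hst : s ≠ t) :
    ∀ u ∈ S \ {s, t}, ∀ v ∈ S \ {s, t}, u ≠ v → ∃ g : MatchingCochain V,
      ∀ q, q + 2 = k → ∀ y ∈ matchingChains ((S \ {s, t}) \ {u, v}) q,
      h s u v y + h t u v y - h s t v y - h s t u y + f (edgeGen u v * (edgeGen s t * y)) =
        g (simplicialBoundary (Sym2 V) y) := by
  intro u hu v hv huv
  by_cases hk : ∃ q, q + 2 = k
  swap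
  · exact ⟨0, fun q hq => (hk ⟨q, hq⟩).elim⟩
  obtain ⟨q, rfl⟩ := hk
  simp only [Finset.mem_sdiff, Finset.mem_insert, Finset.mem_singleton, not_or] at hu hv
  obtain ⟨hu, hus : u ≠ s, hut : u ≠ t⟩ := hu
  obtain ⟨hv, hvs : v ≠ s, hvt : v ≠ t⟩ := hv
  -- At least 3(q + 2) - 4 = 3q + 2 vertices remain, so the vanishing theorem just applies.
  obtain ⟨g, hg⟩ := exists_eq_comp_simplicialBoundary q ((S \ {s, t}) \ {u, v})
    (h s u v + h t u v - h s t v - h s t u +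
      f ∘ₗ LinearMap.mulLeft ℤ (edgeGen u v) ∘ₗ LinearMap.mulLeft ℤ (edgeGen s t)) (by
      have h1 := Finset.le_card_sdiff {u, v} (S \ {s, t})
      have h2 := Finset.le_card_sdiff {s, t} S
      rw [Finset.card_pair huv] at h1
      rw [Finset.card_pair hst] at h2
      omega) (by
    intro y hy
    have e1 := hh s hs u hu v hv hus.symm hvs.symm huv (q + 1) rfl y
      (matchingChains_mono (by grind) _ hy)
    have e2 := hh t ht u hu v hv hut.symm hvt.symm huv (q + 1) rfl y
      (matchingChains_mono (by grind) _ hy)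
    have e3 := hh s hs t ht v hv hst hvs.symm hvt.symm (q + 1) rfl y
      (matchingChains_mono (by grind) _ hy)
    have e4 := hh s hs t ht u hu hst hus.symm hut.symm (q + 1) rfl y
      (matchingChains_mono (by grind) _ hy)
    have e5 := hf (edgeGen u v * (edgeGen s t * y)) (edgeGen_mul_mem (T := S \ {u, v})
      (edgeGen_mul_mem hy (by grind) (by grind) hst (by grind)) hu hv huv le_rfl)
    simp only [simplicialBoundary_edgeGen_mul, mul_sub, map_sub, triangleSum, add_mul,
      map_add] at e1 e2 e3 e4 e5
    simp only [LinearMap.add_apply, LinearMap.sub_apply, LinearMap.comp_apply,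
      LinearMap.mulLeft_apply, ← e1, ← e2, ← e3, ← e4]
    rw [edgeGen_comm u s, edgeGen_comm v t]
    linear_combination e5 +
      (f (edgeGen u v * y) - f (edgeGen s t * y)) * three_eq_zero_zmod)
  refine ⟨g, fun r hr y hy => ?_⟩
  obtain rfl : r = q := by omega
  exact hg y hy

-- The primitive is assembled by how b and c are covered: f contracted with st when both are free,
-- `h s t` with opposite signs when one is joined to S, and the quadrangle cochain when both are.
set_option maxHeartbeats 1000000 in
theorem TriangleExtension.contractsTriangle_vertex (H : TriangleExtension S a b c α f h F)
    (hb : b ∉ S) (hc : c ∉ S) (hbc : b ≠ c)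
    (hS : 3 * k ≤ S.card)
    (hf : ∀ y ∈ matchingChains S (k + 1), f (simplicialBoundary (Sym2 V) y) = 0)
    (hh : ∀ s ∈ S, ∀ t ∈ S, ∀ u ∈ S, s ≠ t → s ≠ u → t ≠ u → ∀ q, q + 1 = k →
      ∀ y ∈ matchingChains (S \ {s, t, u}) q,
      f (triangleSum s t u * y) = h s t u (simplicialBoundary (Sym2 V) y))
    {s t : V} (hs : s ∈ S) (ht : t ∈ S) (hst : s ≠ t) :
    ContractsTriangle (insert a (insert b (insert c S))) (k + 1) F a s t := by
  have hex := exists_quadrangle_cochain hS hf hh hs ht hst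
  choose! i hi using hex
  obtain ⟨g, g0, g1, g2, g3, g4⟩ := exists_cochain_two_vertices (S := S \ {s, t}) (b := b) (c := c)
    (by simp [hb]) (by simp [hc]) hbc (-(α • f ∘ₗ LinearMap.mulLeft ℤ (edgeGen s t))) 0
    (fun u => -h s t u) (fun v => h s t v) i
  refine ⟨g, fun q hq y hy => ?_⟩
  obtain rfl : q = k := by omega
  refine sub_eq_zero.1 (cochain_eq_zero_of_two_vertices (S := S \ {s, t}) (b := b) (c := c)
    (by simp [hc]) hbc (p := q)
    (F ∘ₗ LinearMap.mulLeft ℤ (triangleSum a s t) - g ∘ₗ simplicialBoundary (Sym2 V)) ?_ ?_ ?_ ?_ ?_ y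
    (matchingChains_mono (by grind) _ hy))
  · clear hi g1 g2 g3 g4 hh
    intro y hy
    have e1 := H.a1 s hs _ _ (matchingChains_mono (by grind) _ hy)
    have e2 := H.a1 t ht _ _ (matchingChains_mono (by grind) _ hy)
    have e3 := H.base _ _ (edgeGen_mul_mem hy hs ht hst le_rfl)
    have e4 := cochain_eq_of_cocycle hf hs ht hst hy
    have e5 := g0 _ _ (simplicialBoundary_mem hy)
    simp only [LinearMap.neg_apply, LinearMap.smul_apply, LinearMap.comp_apply,
      LinearMap.mulLeft_apply, smul_eq_mul] at e5
    simp only [LinearMap.sub_apply, LinearMap.comp_apply, LinearMap.mulLeft_apply, triangleSum,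
      add_mul, map_add, edgeGen_comm t a, e1, e2, e3, e5, e4]
    linear_combination α * f y * three_eq_zero_zmod
  · clear hi g2 g3 g4 hh
    intro r hr y hy
    have e1 := H.a_bc s hs _ _ (matchingChains_mono (by grind) _ hy)
    have e2 := H.a_bc t ht _ _ (matchingChains_mono (by grind) _ hy)
    have e3 := H.bc _ _ (edgeGen_mul_mem hy hs ht hst le_rfl)
    have e4 := g0 _ _ hy
    have e5 := g1 _ _ (simplicialBoundary_mem hy)
    simp only [LinearMap.neg_apply, LinearMap.smul_apply, LinearMap.comp_apply,
      LinearMap.mulLeft_apply, smul_eq_mul] at e4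
    simp only [LinearMap.sub_apply, LinearMap.comp_apply, LinearMap.mulLeft_apply, triangleSum,
      add_mul, map_add, map_sub, map_neg, edgeGen_comm t a, simplicialBoundary_edgeGen_mul,
      edgeGen_mul_left_swap s t b c, e1, e2, e3, e4, e5, LinearMap.zero_apply]
    ring
  · clear hi g3 g4
    intro u hu r hr y hy
    simp only [Finset.mem_sdiff, Finset.mem_insert, Finset.mem_singleton, not_or] at hu
    have e1 := H.ab2 s hs u hu.1 (Ne.symm hu.2.1) _ _ (matchingChains_mono (by grind) _ hy)
    have e2 := H.ab2 t ht u hu.1 (Ne.symm hu.2.2) _ _ (matchingChains_mono (by grind) _ hy)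
    have e3 := H.b1 u hu.1 _ _ (edgeGen_mul_mem (S := S \ {u}) hy (by grind) (by grind) hst
      (by grind))
    have e4 := g0 _ _ (matchingChains_mono Finset.sdiff_subset _ hy)
    have e5 := g2 u (by grind) _ _ (simplicialBoundary_mem hy)
    have e6 := hh s hs t ht u hu.1 hst (Ne.symm hu.2.1) (Ne.symm hu.2.2) r hr y
      (matchingChains_mono (by grind) _ hy)
    simp only [triangleSum, add_mul, map_add, edgeGen_comm u s] at e6
    simp only [LinearMap.neg_apply, LinearMap.smul_apply, LinearMap.comp_apply,
      LinearMap.mulLeft_apply, smul_eq_mul] at e4 e5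
    simp only [LinearMap.sub_apply, LinearMap.comp_apply, LinearMap.mulLeft_apply, triangleSum,
      add_mul, map_add, map_sub, map_neg, edgeGen_comm t a, simplicialBoundary_edgeGen_mul,
      edgeGen_mul_left_swap s t b u, e1, e2, e3, e4, e5]
    linear_combination e6
  · clear hi g2 g4
    intro u hu r hr y hy
    simp only [Finset.mem_sdiff, Finset.mem_insert, Finset.mem_singleton, not_or] at hu
    have e1 := H.ca2 u hu.1 s hs hu.2.1 _ _ (matchingChains_mono (by grind) _ hy)
    have e2 := H.ca2 u hu.1 t ht hu.2.2 _ _ (matchingChains_mono (by grind) _ hy)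
    have e3 := H.c1 u hu.1 _ _ (edgeGen_mul_mem (S := S \ {u}) hy (by grind) (by grind) hst
      (by grind))
    have e4 := g0 _ _ (matchingChains_mono Finset.sdiff_subset _ hy)
    have e5 := g3 u (by grind) _ _ (simplicialBoundary_mem hy)
    have e6 := hh s hs t ht u hu.1 hst (Ne.symm hu.2.1) (Ne.symm hu.2.2) r hr y
      (matchingChains_mono (by grind) _ hy)
    simp only [triangleSum, add_mul, map_add, edgeGen_comm t u] at e6
    simp only [LinearMap.neg_apply, LinearMap.smul_apply, LinearMap.comp_apply,
      LinearMap.mulLeft_apply, smul_eq_mul] at e4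
    simp only [LinearMap.sub_apply, LinearMap.comp_apply, LinearMap.mulLeft_apply, triangleSum,
      add_mul, map_add, map_sub, map_neg, edgeGen_comm t a, simplicialBoundary_edgeGen_mul,
      edgeGen_mul_left_swap _ _ c u, e1, e2, e3, e4, e5]
    linear_combination -e6
  · intro u hu v hv huv r hr y hy
    have e7 := hi u hu v hv huv r hr y hy
    have e4 := g3 v hv _ _ (matchingChains_mono (by grind) _ hy)
    have e5 := g2 u hu _ _ (matchingChains_mono (by grind) _ hy)
    have e6 := g4 u hu v hv huv _ _ (simplicialBoundary_mem (matchingChains_mono (by grind) _ hy))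
    simp only [Finset.mem_sdiff, Finset.mem_insert, Finset.mem_singleton, not_or] at hu hv
    have e1 := H.abc3 s hs u hu.1 v hv.1 (Ne.symm hu.2.1) (Ne.symm hv.2.1) huv _ _
      (matchingChains_mono (by grind) _ hy)
    have e2 := H.abc3 t ht u hu.1 v hv.1 (Ne.symm hu.2.2) (Ne.symm hv.2.2) huv _ _
      (matchingChains_mono (by grind) _ hy)
    have e3 := H.bc2 u hu.1 v hv.1 huv _ _ (edgeGen_mul_mem (S := S \ {u, v}) hy (by grind)
      (by grind) hst (by grind))
    simp only [LinearMap.neg_apply] at e5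
    simp only [LinearMap.sub_apply, LinearMap.comp_apply, LinearMap.mulLeft_apply, triangleSum,
      add_mul, map_add, map_sub, edgeGen_comm t a, simplicialBoundary_edgeGen_mul, mul_sub,
      edgeGen_mul_left_swap s t _ _, mul_neg, neg_neg, e1, e2, e3, e4, e5, e6]
    linear_combination e7

end Triangle

/-! ### Triangles disjoint from abc, and the inductive step -/

section Step

variable {V : Type*} [DecidableEq V] {S : Finset V} {a b c : V} {α : ZMod 3}
  {f F : MatchingCochain V} {h : V → V → V → MatchingCochain V} {k : ℕ}

/-- Contracting f with two disjoint triangles gives opposite results in the two orders, because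
triangle sums anticommute. So the mixed contractions of the two primitives add up to a cocycle, and
the vanishing theorem applies to the vertices outside both triangles. -/
theorem exists_disjoint_triangles_cochain (hS : 3 * k ≤ S.card)
    (hh : ∀ s ∈ S, ∀ t ∈ S, ∀ u ∈ S, s ≠ t → s ≠ u → t ≠ u → ∀ q, q + 1 = k →
      ∀ y ∈ matchingChains (S \ {s, t, u}) q,
      f (triangleSum s t u * y) = h s t u (simplicialBoundary (Sym2 V) y))
    {s t u : V} (hs : s ∈ S) (ht : t ∈ S) (hu : u ∈ S) (hst : s ≠ t) (hsu : s ≠ u) (htu : t ≠ u) :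
    ∀ v ∈ S \ {s, t, u}, ∀ w ∈ S \ {s, t, u}, ∀ z ∈ S \ {s, t, u}, v ≠ w → v ≠ z → w ≠ z →
      ∃ g : MatchingCochain V,
      ∀ q, q + 3 = k → ∀ y ∈ matchingChains ((S \ {s, t, u}) \ {v, w, z}) q,
      h s t u (triangleSum v w z * y) + h v w z (triangleSum s t u * y) =
        g (simplicialBoundary (Sym2 V) y) := by
  intro v hv w hw z hz hvw hvz hwz
  by_cases hk : ∃ q, q + 3 = k
  swap
  · exact ⟨0, fun q hq => (hk ⟨q, hq⟩).elim⟩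
  obtain ⟨q, rfl⟩ := hk
  -- For a triangle sum Δ, ∂(Δ * y) = 3y - Δ * ∂y, so modulo 3 contraction with Δ anticommutes with
  -- ∂.
  have key : ∀ {s t u v w z : V}, s ∈ S → t ∈ S → u ∈ S → s ≠ t → s ≠ u → t ≠ u →
      v ∈ S \ {s, t, u} → w ∈ S \ {s, t, u} → z ∈ S \ {s, t, u} → v ≠ w → v ≠ z → w ≠ z →
      ∀ y ∈ matchingChains ((S \ {s, t, u}) \ {v, w, z}) (q + 1),
      h s t u (triangleSum v w z * simplicialBoundary (Sym2 V) y) =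
        -f (triangleSum s t u * (triangleSum v w z * y)) := by
    intro s t u v w z hs ht hu hst hsu htu hv hw hz hvw hvz hwz y hy
    have e := hh s hs t ht u hu hst hsu htu (q + 2) rfl (triangleSum v w z * y)
      (triangleSum_mul_mem hy hv hw hz hvw hvz hwz le_rfl)
    rw [e]
    simp only [triangleSum, add_mul, map_add, simplicialBoundary_edgeGen_mul, map_sub]
    linear_combination (h s t u y) * three_eq_zero_zmod
  obtain ⟨g, hg⟩ := exists_eq_comp_simplicialBoundary q ((S \ {s, t, u}) \ {v, w, z})
    (h s t u ∘ₗ LinearMap.mulLeft ℤ (triangleSum v w z) +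
      h v w z ∘ₗ LinearMap.mulLeft ℤ (triangleSum s t u)) (by
      have h1 := Finset.le_card_sdiff {v, w, z} (S \ {s, t, u})
      have h2 := Finset.le_card_sdiff {s, t, u} S
      have h3 := Finset.card_le_three (a := v) (b := w) (c := z)
      have h4 := Finset.card_le_three (a := s) (b := t) (c := u)
      omega) (by
    intro y hy
    have e1 := key hs ht hu hst hsu htu hv hw hz hvw hvz hwz y hy
    simp only [Finset.mem_sdiff, Finset.mem_insert, Finset.mem_singleton, not_or] at hv hw hz
    have e2 := key (s := v) (t := w) (u := z) (v := s) (w := t) (z := u) hv.1 hw.1 hz.1 hvw hvz hwz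
      (by grind) (by grind) (by grind) hst hsu htu y (matchingChains_mono (by grind) _ hy)
    have e3 : triangleSum v w z * (triangleSum s t u * y) =
        -(triangleSum s t u * (triangleSum v w z * y)) := by
      have : ∀ x, triangleSum v w z * x =
        edgeGen v w * x + edgeGen w z * x + edgeGen z v * x := fun x => by
        simp only [triangleSum, add_mul]
      rw [this, this y]
      simp only [mul_add, triangleSum_mul_edgeGen_mul]
      abel
    simp only [LinearMap.add_apply, LinearMap.comp_apply, LinearMap.mulLeft_apply]
    rw [e1, e2, e3, map_neg]
    ring)
  refine ⟨g, fun r hr y hy => ?_⟩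
  obtain rfl : r = q := by omega
  exact hg y hy

-- Contraction with stu turns an extension of f into an extension of the contracted cochain, up to
-- sign. So the primitive is itself a triangle extension, of `h s t u` on S without s, t, u, with
-- the disjoint-triangles cochains `j` as its top values.
set_option maxHeartbeats 1000000 in
theorem TriangleExtension.contractsTriangle_of_mem (H : TriangleExtension S a b c α f h F)
    (ha : a ∉ S) (hb : b ∉ S) (hc : c ∉ S) (hab : a ≠ b) (hac : a ≠ c) (hbc : b ≠ c)
    (hS : 3 * k ≤ S.card)
    (hh : ∀ s ∈ S, ∀ t ∈ S, ∀ u ∈ S, s ≠ t → s ≠ u → t ≠ u → ∀ q, q + 1 = k →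
      ∀ y ∈ matchingChains (S \ {s, t, u}) q,
      f (triangleSum s t u * y) = h s t u (simplicialBoundary (Sym2 V) y))
    {s t u : V} (hs : s ∈ S) (ht : t ∈ S) (hu : u ∈ S) (hst : s ≠ t) (hsu : s ≠ u) (htu : t ≠ u) :
    ContractsTriangle (insert a (insert b (insert c S))) (k + 1) F s t u := by
  have hex := exists_disjoint_triangles_cochain hS hh hs ht hu hst hsu htu
  choose! j hj using hex
  obtain ⟨T, hT⟩ : ∃ T, T = S \ {s, t, u} := ⟨_, rfl⟩
  have hTS : T ⊆ S := hT ▸ Finset.sdiff_subset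
  obtain ⟨g, hg⟩ := exists_triangleExtension (S := T) (a := a) (b := b) (c := c)
    (fun h => ha (hTS h)) (fun h => hb (hTS h)) (fun h => hc (hTS h)) hab hac hbc α (h s t u)
    (fun v w z => j v w z)
  have hm : ∀ {R : Finset V} {p : ℕ} {y : ExteriorAlgebra ℤ (Sym2 V →₀ ℤ)},
      R ⊆ T → y ∈ matchingChains R p → y ∈ matchingChains T p :=
    fun hR hy => matchingChains_mono hR _ hy
  have htri : ∀ R : Finset V, (∀ x ∈ R, x ∈ T) → ∀ {p : ℕ} {y : ExteriorAlgebra ℤ (Sym2 V →₀ ℤ)},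
      y ∈ matchingChains (T \ R) p → triangleSum s t u * y ∈ matchingChains (S \ R) (p + 1) := by
    intro R hR p y hy
    subst hT
    have hR' : ∀ x ∈ R, x ≠ s ∧ x ≠ t ∧ x ≠ u := fun x hx => by
      simpa using (Finset.mem_sdiff.1 (hR x hx)).2
    refine triangleSum_mul_mem hy ?_ ?_ ?_ hst hsu htu ?_
    · exact Finset.mem_sdiff.2 ⟨hs, fun h => (hR' s h).1 rfl⟩
    · exact Finset.mem_sdiff.2 ⟨ht, fun h => (hR' t h).2.1 rfl⟩
    · exact Finset.mem_sdiff.2 ⟨hu, fun h => (hR' u h).2.2 rfl⟩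
    · rw [sdiff_right_comm]
  have htri0 : ∀ {p : ℕ} {y : ExteriorAlgebra ℤ (Sym2 V →₀ ℤ)},
      y ∈ matchingChains T p → triangleSum s t u * y ∈ matchingChains S (p + 1) := by
    intro p y hy
    simpa using htri ∅ (by simp) (y := y) (p := p) (by simpa using hy)
  have hf1 : ∀ q, q + 1 = k → ∀ y ∈ matchingChains T q,
      f (triangleSum s t u * y) = h s t u (simplicialBoundary (Sym2 V) y) := by
    subst hT
    exact hh s hs t ht u hu hst hsu htu
  have hf2 : ∀ v ∈ T, ∀ w ∈ T, v ≠ w → ∀ q, q + 2 = k → ∀ y ∈ matchingChains (T \ {v, w}) q,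
      f (edgeGen v w * (triangleSum s t u * y)) =
        h s t u (edgeGen v w * simplicialBoundary (Sym2 V) y) - h s t u y := by
    intro v hv w hw hvw q hq y hy
    have := hf1 (q + 1) hq (edgeGen v w * y) (edgeGen_mul_mem hy hv hw hvw le_rfl)
    rw [triangleSum_mul_edgeGen_mul, simplicialBoundary_edgeGen_mul, map_neg, map_sub] at this
    linear_combination -this
  refine ⟨g, fun q hq y hy => ?_⟩
  obtain rfl : q = k := by omega
  refine sub_eq_zero.1 (cochain_eq_zero_of_three_vertices (S := T) (a := a) (b := b) (c := c)
    (fun h => hb (hTS h)) (fun h => hc (hTS h)) hab hac hbc (p := q)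
    (F ∘ₗ LinearMap.mulLeft ℤ (triangleSum s t u) - g ∘ₗ simplicialBoundary (Sym2 V))
    ?_ ?_ ?_ ?_ ?_ ?_ ?_ ?_ ?_ ?_ ?_ ?_ ?_ ?_ y
    (matchingChains_mono (by grind) _ hy))
  all_goals simp only [LinearMap.sub_apply, LinearMap.comp_apply, LinearMap.mulLeft_apply,
    triangleSum_mul_edgeGen_mul, simplicialBoundary_edgeGen_mul, map_neg, map_sub, mul_neg, mul_sub]
  · intro y hy
    rw [H.base _ _ (htri0 hy), hg.base _ _ (simplicialBoundary_mem hy), sub_zero]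
  · intro r hr y hy
    rw [H.bc _ _ (htri0 hy), hg.base _ _ hy, hg.bc _ _ (simplicialBoundary_mem hy), hf1 r hr y hy]
    ring
  · intro r hr y hy
    rw [H.ca _ _ (htri0 hy), hg.base _ _ hy, hg.ca _ _ (simplicialBoundary_mem hy), hf1 r hr y hy]
    ring
  · intro r hr y hy
    rw [H.ab _ _ (htri0 hy), hg.base _ _ hy, hg.ab _ _ (simplicialBoundary_mem hy), hf1 r hr y hy]
    ring
  · intro v hv r hr y hy
    have hy' := hm Finset.sdiff_subset hy
    rw [H.a1 v (hTS hv) _ _ (htri {v} (by simpa using hv) hy), hg.base _ _ hy',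
      hg.a1 v hv _ _ (simplicialBoundary_mem hy), hf1 r hr y hy']
    ring
  · intro v hv r hr y hy
    have hy' := hm Finset.sdiff_subset hy
    rw [H.b1 v (hTS hv) _ _ (htri {v} (by simpa using hv) hy), hg.base _ _ hy',
      hg.b1 v hv _ _ (simplicialBoundary_mem hy), hf1 r hr y hy']
    ring
  · intro v hv r hr y hy
    have hy' := hm Finset.sdiff_subset hy
    rw [H.c1 v (hTS hv) _ _ (htri {v} (by simpa using hv) hy), hg.base _ _ hy',
      hg.c1 v hv _ _ (simplicialBoundary_mem hy), hf1 r hr y hy']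
    ring
  · intro v hv r hr y hy
    have hy' := hm Finset.sdiff_subset hy
    rw [H.a_bc v (hTS hv) _ _ (htri {v} (by simpa using hv) hy), hg.bc _ _ hy', hg.a1 v hv _ _ hy,
      hg.a_bc v hv _ _ (simplicialBoundary_mem hy)]
    ring
  · intro v hv r hr y hy
    have hy' := hm Finset.sdiff_subset hy
    rw [H.b_ca v (hTS hv) _ _ (htri {v} (by simpa using hv) hy), hg.ca _ _ hy', hg.b1 v hv _ _ hy,
      hg.b_ca v hv _ _ (simplicialBoundary_mem hy)]
    ring
  · intro v hv r hr y hy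
    have hy' := hm Finset.sdiff_subset hy
    rw [H.c_ab v (hTS hv) _ _ (htri {v} (by simpa using hv) hy), hg.ab _ _ hy', hg.c1 v hv _ _ hy,
      hg.c_ab v hv _ _ (simplicialBoundary_mem hy)]
    ring
  · intro v hv w hw hvw r hr y hy
    have hyv : y ∈ matchingChains (T \ {v}) r :=
      matchingChains_mono (Finset.sdiff_subset_sdiff le_rfl (by simp)) _ hy
    have hyw : y ∈ matchingChains (T \ {w}) r :=
      matchingChains_mono (Finset.sdiff_subset_sdiff le_rfl (by simp)) _ hy
    have e := H.ab2 v (hTS hv) w (hTS hw) hvw _ _ (htri {v, w} (by simp [hv, hw]) hy)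
    rw [neg_neg, e, hg.b1 w hw _ _ hyw, hg.a1 v hv _ _ hyv,
      hg.ab2 v hv w hw hvw _ _ (simplicialBoundary_mem hy), hf2 v hv w hw hvw r hr y hy]
    ring
  · intro v hv w hw hvw r hr y hy
    have hyv : y ∈ matchingChains (T \ {v}) r :=
      matchingChains_mono (Finset.sdiff_subset_sdiff le_rfl (by simp)) _ hy
    have hyw : y ∈ matchingChains (T \ {w}) r :=
      matchingChains_mono (Finset.sdiff_subset_sdiff le_rfl (by simp)) _ hy
    have e := H.bc2 v (hTS hv) w (hTS hw) hvw _ _ (htri {v, w} (by simp [hv, hw]) hy)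
    rw [neg_neg, e, hg.c1 w hw _ _ hyw, hg.b1 v hv _ _ hyv,
      hg.bc2 v hv w hw hvw _ _ (simplicialBoundary_mem hy), hf2 v hv w hw hvw r hr y hy]
    linear_combination -(h s t u y) * three_eq_zero_zmod
  · intro v hv w hw hvw r hr y hy
    have hyv : y ∈ matchingChains (T \ {v}) r :=
      matchingChains_mono (Finset.sdiff_subset_sdiff le_rfl (by simp)) _ hy
    have hyw : y ∈ matchingChains (T \ {w}) r :=
      matchingChains_mono (Finset.sdiff_subset_sdiff le_rfl (by simp)) _ hy
    have e := H.ca2 v (hTS hv) w (hTS hw) hvw _ _ (htri {v, w} (by simp [hv, hw]) hy)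
    rw [neg_neg, e, hg.a1 w hw _ _ hyw, hg.c1 v hv _ _ hyv,
      hg.ca2 v hv w hw hvw _ _ (simplicialBoundary_mem hy), hf2 v hv w hw hvw r hr y hy]
    ring
  · intro v hv w hw z hz hvw hvz hwz r hr y hy
    have e := H.abc3 v (hTS hv) w (hTS hw) z (hTS hz) hvw hvz hwz _ _
      (htri {v, w, z} (by simp [hv, hw, hz]) hy)
    have e1 := hg.bc2 w hw z hz hwz r y
      (matchingChains_mono (Finset.sdiff_subset_sdiff le_rfl (by simp)) _ hy)
    have e2 := hg.ca2 z hz v hv hvz.symm r y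
      (matchingChains_mono (Finset.sdiff_subset_sdiff le_rfl
        (by simp [Finset.insert_subset_iff])) _ hy)
    have e3 := hg.ab2 v hv w hw hvw r y
      (matchingChains_mono (Finset.sdiff_subset_sdiff le_rfl
        (by simp [Finset.insert_subset_iff])) _ hy)
    have e4 := hg.abc3 v hv w hw z hz hvw hvz hwz _ _ (simplicialBoundary_mem hy)
    subst hT
    have e5 := hj v hv w hw z hz hvw hvz hwz r hr y hy
    simp only [edgeGen_mul_left_swap a v c z y, map_neg, neg_neg, e, e1, e2, e3, e4]
    have e6 : h s t u (triangleSum v w z * y) = h s t u (edgeGen v w * y) +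
        h s t u (edgeGen w z * y) + h s t u (edgeGen z v * y) := by
      rw [triangleSum, add_mul, add_mul, map_add, map_add]
    rw [← e5, e6]
    ring

theorem forall_triples_of_symmetric {V : Type*} {S : Finset V} {a b c : V} {P : V → V → V → Prop} (hr : ∀ {x y z}, P x y z → P y z x)
    (hw : ∀ {x y z}, P x y z → P y x z) (t0 : P a b c)
    (tab : ∀ s ∈ S, P a b s) (tbc : ∀ s ∈ S, P b c s) (tca : ∀ s ∈ S, P c a s)
    (ta : ∀ s ∈ S, ∀ t ∈ S, s ≠ t → P a s t) (tb : ∀ s ∈ S, ∀ t ∈ S, s ≠ t → P b s t)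
    (tc : ∀ s ∈ S, ∀ t ∈ S, s ≠ t → P c s t)
    (tS : ∀ s ∈ S, ∀ t ∈ S, ∀ u ∈ S, s ≠ t → s ≠ u → t ≠ u → P s t u) {s t u : V}
    (hs : s = a ∨ s = b ∨ s = c ∨ s ∈ S) (ht : t = a ∨ t = b ∨ t = c ∨ t ∈ S)
    (hu : u = a ∨ u = b ∨ u = c ∨ u ∈ S) (hst : s ≠ t) (hsu : s ≠ u) (htu : t ≠ u) : P s t u := by
  rcases hs with rfl | rfl | rfl | hs <;> rcases ht with rfl | rfl | rfl | ht <;>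
    rcases hu with rfl | rfl | rfl | hu <;>
    first
    | contradiction
    | exact t0
    | exact hw t0
    | exact hr t0
    | exact hw (hr t0)
    | exact hr (hr t0)
    | exact hw (hr (hr t0))
    | exact tS _ hs _ ht _ hu hst hsu htu
    | exact ta _ ht _ hu htu
    | exact hw (ta _ hs _ hu hsu)
    | exact hr (ta _ hs _ ht hst)
    | exact tb _ ht _ hu htu
    | exact hw (tb _ hs _ hu hsu)
    | exact hr (tb _ hs _ ht hst)
    | exact tc _ ht _ hu htu
    | exact hw (tc _ hs _ hu hsu)
    | exact hr (tc _ hs _ ht hst)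
    | exact tab _ hu
    | exact hw (tab _ hu)
    | exact hw (hr (tab _ ht))
    | exact hw (hr (hr (tab _ ht)))
    | exact hr (tab _ ht)
    | exact hr (hr (tab _ hs))
    | exact hw (hr (tab _ hs))
    | exact tbc _ hu
    | exact hw (tbc _ hu)
    | exact hw (hr (tbc _ ht))
    | exact hw (hr (hr (tbc _ ht)))
    | exact hr (tbc _ ht)
    | exact hr (hr (tbc _ hs))
    | exact hw (hr (tbc _ hs))
    | exact tca _ hu
    | exact hw (tca _ hu)
    | exact hw (hr (tca _ ht))
    | exact hw (hr (hr (tca _ ht)))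
    | exact hr (tca _ ht)
    | exact hr (hr (tca _ hs))
    | exact hw (hr (tca _ hs))

/-- The values on ab and bc differ by exactly f, whence the last clause. Triangles are sorted by how
many of a, b, c they contain, and rotation reduces these types to those involving a, or a and b. -/
theorem IsTriangularCocycle.exists_extension (H : IsTriangularCocycle S k f) (ha : a ∉ S)
    (hb : b ∉ S) (hc : c ∉ S) (hab : a ≠ b) (hac : a ≠ c) (hbc : b ≠ c) :
    ∃ F, IsTriangularCocycle (insert a (insert b (insert c S))) (k + 1) F ∧
      ∀ p, ∀ y ∈ matchingChains S p, F ((edgeGen a b - edgeGen b c) * y) = f y := by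
  have hex := H.triangle
  unfold ContractsTriangle at hex
  choose! h hh using hex
  obtain ⟨F, hF⟩ := exists_triangleExtension ha hb hc hab hac hbc 0 f h
  have hS1 : insert b (insert c (insert a S)) = insert a (insert b (insert c S)) := by
    grind
  have hS2 : insert c (insert a (insert b S)) = insert a (insert b (insert c S)) := by
    grind
  have hF1 := hF.rotate
  have hF2 := hF1.rotate
  have hh1 : ∀ t ∈ S, ∀ u ∈ S, ∀ s ∈ S, t ≠ u → t ≠ s → u ≠ s → ∀ q, q + 1 = k →
      ∀ y ∈ matchingChains (S \ {t, u, s}) q,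
      f (triangleSum t u s * y) = h s t u (simplicialBoundary (Sym2 V) y) := by
    intro t ht u hu s hs htu hts hus q hq y hy
    rw [triangleSum_rotate]
    exact hh s hs t ht u hu hts.symm hus.symm htu q hq y (matchingChains_mono (by grind) _ hy)
  have hh2 : ∀ u ∈ S, ∀ s ∈ S, ∀ t ∈ S, u ≠ s → u ≠ t → s ≠ t → ∀ q, q + 1 = k →
      ∀ y ∈ matchingChains (S \ {u, s, t}) q,
      f (triangleSum u s t * y) = h s t u (simplicialBoundary (Sym2 V) y) := by
    intro u hu s hs t ht hus hut hst q hq y hy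
    rw [triangleSum_rotate]
    exact hh1 t ht u hu s hs hut.symm hst.symm hus q hq y (matchingChains_mono (by grind) _ hy)
  have t0 : ContractsTriangle (insert a (insert b (insert c S))) (k + 1) F a b c :=
    hF.contractsTriangle_triangle
  have tab : ∀ s ∈ S, ContractsTriangle (insert a (insert b (insert c S))) (k + 1) F a b s :=
    fun s hs => hF.contractsTriangle_edge hs
  have tbc : ∀ s ∈ S, ContractsTriangle (insert a (insert b (insert c S))) (k + 1) F b c s :=
    fun s hs => hS1 ▸ hF1.contractsTriangle_edge hs
  have tca : ∀ s ∈ S, ContractsTriangle (insert a (insert b (insert c S))) (k + 1) F c a s :=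
    fun s hs => hS2 ▸ hF2.contractsTriangle_edge hs
  have ta : ∀ s ∈ S, ∀ t ∈ S, s ≠ t →
      ContractsTriangle (insert a (insert b (insert c S))) (k + 1) F a s t :=
    fun s hs t ht hst => hF.contractsTriangle_vertex hb hc hbc H.card H.cocycle hh hs ht hst
  have tb : ∀ s ∈ S, ∀ t ∈ S, s ≠ t →
      ContractsTriangle (insert a (insert b (insert c S))) (k + 1) F b s t :=
    fun s hs t ht hst =>
      hS1 ▸ hF1.contractsTriangle_vertex hc ha hac.symm H.card H.cocycle hh1 hs ht hst
  have tc : ∀ s ∈ S, ∀ t ∈ S, s ≠ t →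
      ContractsTriangle (insert a (insert b (insert c S))) (k + 1) F c s t :=
    fun s hs t ht hst =>
      hS2 ▸ hF2.contractsTriangle_vertex ha hb hab H.card H.cocycle hh2 hs ht hst
  have tS : ∀ s ∈ S, ∀ t ∈ S, ∀ u ∈ S, s ≠ t → s ≠ u → t ≠ u →
      ContractsTriangle (insert a (insert b (insert c S))) (k + 1) F s t u :=
    fun s hs t ht u hu hst hsu htu =>
      hF.contractsTriangle_of_mem ha hb hc hab hac hbc H.card hh hs ht hu hst hsu htu
  refine ⟨F, ⟨?_, hF.cocycle hb hc hab hac hbc H.cocycle hh, ?_⟩, ?_⟩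
  · rw [Finset.card_insert_of_notMem (by simp [ha, hab, hac]),
      Finset.card_insert_of_notMem (by simp [hb, hbc]), Finset.card_insert_of_notMem hc]
    have := H.card
    omega
  · intro s hs t ht u hu hst hsu htu
    simp only [Finset.mem_insert] at hs ht hu
    generalize insert a (insert b (insert c S)) = T at *
    exact forall_triples_of_symmetric (P := ContractsTriangle T (k + 1) F) (fun h => h.rotate)
      (fun h => h.swap) t0 tab tbc tca ta tb tc tS hs ht hu hst hsu htu
  · intro p y hy
    rw [sub_mul, map_sub, hF.ab _ _ hy, hF.bc _ _ hy]
    ring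

end Step

/-! ### Detected cycles and the homology of matching complexes of graphs -/

section Homology

/-- A list of pairwise disjoint edges of the graph `G` with all end points in `S`. -/
structure IsMatchingList {V : Type*} (G : SimpleGraph V) (S : Finset V) (l : List (Sym2 V)) : Prop where
  nodup : l.Nodup
  edge : ∀ e ∈ l, e ∈ G.edgeSet
  sub : ∀ e ∈ l, ∀ v ∈ e, v ∈ S
  disj : ∀ v : V, ∀ e ∈ l, ∀ f ∈ l, v ∈ e → v ∈ f → e = f

/-- The span of the oriented matchings of `G` with `p` edges inside `S`. -/
noncomputable def graphMatchingChains {V : Type*} (G : SimpleGraph V) (S : Finset V) (p : ℕ) :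
    Submodule ℤ (ExteriorAlgebra ℤ (Sym2 V →₀ ℤ)) :=
  Submodule.span ℤ {w | ∃ l, IsMatchingList G S l ∧ l.length = p ∧ w = orientedSimplex l}

variable {V : Type*} {G : SimpleGraph V}

theorem orientedSimplex_cons_mk (u v : V) (l : List (Sym2 V)) :
    orientedSimplex (s(u, v) :: l) = edgeGen u v * orientedSimplex l := by
  simp [orientedSimplex, edgeGen]

theorem graphMatchingChains_mono {S T : Finset V} (hST : S ⊆ T) (p : ℕ) :
    graphMatchingChains G S p ≤ graphMatchingChains G T p :=
  Submodule.span_mono fun _ ⟨l, hl, h⟩ =>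
    ⟨l, ⟨hl.nodup, hl.edge, fun e he v hv => hST (hl.sub e he v hv), hl.disj⟩, h⟩

variable [DecidableEq V]

theorem edgeGen_mul_mem_graphMatchingChains {S T : Finset V} {u v : V} (huv : G.Adj u v)
    (hu : u ∈ S) (hv : v ∈ S) (hT : T ⊆ S \ {u, v}) {p : ℕ}
    {y : ExteriorAlgebra ℤ (Sym2 V →₀ ℤ)} (hy : y ∈ graphMatchingChains G T p) :
    edgeGen u v * y ∈ graphMatchingChains G S (p + 1) := by
  have : graphMatchingChains G T p ≤
      (graphMatchingChains G S (p + 1)).comap (LinearMap.mulLeft ℤ (edgeGen u v)) := by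
    refine Submodule.span_le.2 ?_
    rintro w ⟨l, hl, hp, rfl⟩
    have hfree : ∀ e ∈ l, u ∉ e ∧ v ∉ e := fun e he =>
      ⟨fun h => by simpa using hT (hl.sub e he u h), fun h => by simpa using hT (hl.sub e he v h)⟩
    refine Submodule.subset_span ⟨s(u, v) :: l, ⟨?_, ?_, ?_, ?_⟩, by simp [hp],
      (orientedSimplex_cons_mk u v l).symm⟩
    · exact List.nodup_cons.2 ⟨fun h => (hfree _ h).1 (by simp), hl.nodup⟩
    · intro e he
      rcases List.mem_cons.1 he with rfl | he
      · exact huv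
      · exact hl.edge e he
    · intro e he x hx
      rcases List.mem_cons.1 he with rfl | he
      · rcases Sym2.mem_iff.1 hx with rfl | rfl <;> assumption
      · exact (Finset.mem_sdiff.1 (hT (hl.sub e he x hx))).1
    · intro x e he f hf hxe hxf
      rcases List.mem_cons.1 he with rfl | he' <;> rcases List.mem_cons.1 hf with rfl | hf'
      · rfl
      · rcases Sym2.mem_iff.1 hxe with rfl | rfl
        · exact ((hfree f hf').1 hxf).elim
        · exact ((hfree f hf').2 hxf).elim
      · rcases Sym2.mem_iff.1 hxf with rfl | rfl
        · exact ((hfree e he').1 hxe).elim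
        · exact ((hfree e he').2 hxe).elim
      · exact hl.disj x e he' f hf' hxe hxf
  exact this hy

theorem IsMatchingList.isMatchingMonomial {S : Finset V} {l : List (Sym2 V)}
    (hl : IsMatchingList G S l) : IsMatchingMonomial S l.length (orientedSimplex l) := by
  induction l generalizing S with
  | nil => exact .one S
  | cons e l ih =>
    induction e using Sym2.ind with
    | _ u v =>
    have hne : u ≠ v := G.ne_of_adj (hl.edge s(u, v) (by simp))
    rw [orientedSimplex_cons_mk]
    have hn := List.nodup_cons.1 hl.nodup
    refine .mul u v (hl.sub s(u, v) (by simp) u (by simp)) (hl.sub s(u, v) (by simp) v (by simp))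
      hne (ih ⟨hn.2, fun e he => hl.edge e (by simp [he]), fun e he x hx => ?_,
        fun x e he f hf => hl.disj x e (by simp [he]) f (by simp [hf])⟩)
    refine Finset.mem_sdiff.2 ⟨hl.sub e (by simp [he]) x hx, fun hx' => hn.1 ?_⟩
    have hx2 : x ∈ s(u, v) := by simpa using hx'
    exact (hl.disj x s(u, v) (by simp) e (by simp [he]) hx2 hx) ▸ he

/-- This lets a cocycle on the complete graph serve every G. -/
theorem graphMatchingChains_le_matchingChains (S : Finset V) (p : ℕ) :
    graphMatchingChains G S p ≤ matchingChains S p :=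
  Submodule.span_le.2 fun _ ⟨_, hl, hp, hw⟩ =>
    Submodule.subset_span (hw ▸ hp ▸ hl.isMatchingMonomial)

theorem simplicialChains_eq_graphMatchingChains [Fintype V] {t : ℤ} {p : ℕ} (ht : t + 1 = p) :
    simplicialChains (matchingComplexOf G) t = graphMatchingChains G Finset.univ p := by
  refine congrArg _ (Set.ext fun w => ⟨?_, ?_⟩)
  · rintro ⟨l, hl, hp, hK, rfl⟩
    refine ⟨l, ?_, by omega, rfl⟩
    rcases hK with hK | hK
    · obtain rfl := List.toFinset_eq_empty_iff l |>.1 hK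
      exact ⟨hl, by simp, by simp, by simp⟩
    · obtain ⟨-, h1, h2⟩ := hK
      exact ⟨hl, by simpa using h1, by simp, by simpa using h2⟩
  · rintro ⟨l, hl, hp, rfl⟩
    refine ⟨l, hl.nodup, by omega, ?_, rfl⟩
    rcases l.toFinset.eq_empty_or_nonempty with h | h
    · exact Or.inl h
    · exact Or.inr ⟨h, by simpa using hl.edge, by simpa using hl.disj⟩

/-- A cycle is not a boundary if some cochain takes a nonzero value on it and vanishes on all
boundaries. -/
theorem nontrivial_reducedHomology [Fintype V] {t : ℤ} {p : ℕ} (ht : t + 1 = p)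
    {z : ExteriorAlgebra ℤ (Sym2 V →₀ ℤ)} (hz : z ∈ graphMatchingChains G Finset.univ p)
    (hz0 : simplicialBoundary (Sym2 V) z = 0) (f : MatchingCochain V)
    (hf : ∀ w ∈ graphMatchingChains G Finset.univ (p + 1), f (simplicialBoundary (Sym2 V) w) = 0)
    (hfz : f z ≠ 0) : Nontrivial (reducedHomology (matchingComplexOf G) t) := by
  refine Submodule.Quotient.nontrivial_iff.2 fun htop => hfz ?_
  have hmem : z ∈ simplicialCycles (matchingComplexOf G) t :=
    ⟨by rwa [simplicialChains_eq_graphMatchingChains ht], hz0⟩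
  have h1 : (⟨z, hmem⟩ : simplicialCycles (matchingComplexOf G) t) ∈
      (simplicialBoundaries (matchingComplexOf G) t).comap
        (simplicialCycles (matchingComplexOf G) t).subtype := htop ▸ Submodule.mem_top
  obtain ⟨w, hw, hwz⟩ := h1
  rw [SetLike.mem_coe,
    simplicialChains_eq_graphMatchingChains (show t + 1 + 1 = ((p + 1 : ℕ) : ℤ) by
      push_cast; omega)] at hw
  have hwz' : simplicialBoundary (Sym2 V) w = z := hwz
  rw [← hwz', hf w hw]

/-- With at most one vertex there are no edges and no triangles, so the scalar part modulo 3 is a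
cocycle. This base restricts the induction to 3k or 3k + 1 vertices. -/
theorem exists_isTriangularCocycle_zero {S : Finset V} (hS : S.card ≤ 1) :
    ∃ f : MatchingCochain V, IsTriangularCocycle S 0 f ∧ f 1 = 1 := by
  refine ⟨(Int.castAddHom (ZMod 3)).toIntLinearMap ∘ₗ
    (ExteriorAlgebra.algebraMapInv (R := ℤ) (M := Sym2 V →₀ ℤ)).toLinearMap, ⟨by simp, ?_, ?_⟩, by simp⟩
  · have : matchingChains S 1 ≤ ⊥ := by
      refine Submodule.span_le.2 ?_
      rintro w (_ | ⟨u, v, hu, hv, huv, -⟩)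
      exact (huv (Finset.card_le_one.1 hS u hu v hv)).elim
    intro y hy
    rw [(Submodule.mem_bot ℤ).1 (this hy), map_zero, map_zero]
  · intro s hs t ht u _ hst
    exact (hst (Finset.card_le_one.1 hS s hs t ht)).elim

/-- The data of a cycle `z` of `p` disjoint edges of `G` inside `S` and of a cochain that shows that
`z` is not a boundary. -/
def HasDetectedCycle (G : SimpleGraph V) (S : Finset V) (p : ℕ) : Prop :=
  ∃ z ∈ graphMatchingChains G S p, simplicialBoundary (Sym2 V) z = 0 ∧
    ∃ f : MatchingCochain V, IsTriangularCocycle S p f ∧ f z = 1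

/-- The factor ab - bc has boundary zero. The edge ca need not belong to G, so bipartite graphs are
allowed. -/
theorem HasDetectedCycle.extend {S : Finset V} {p : ℕ} (H : HasDetectedCycle G S p) {a b c : V}
    (ha : a ∉ S) (hb : b ∉ S) (hc : c ∉ S) (hac : a ≠ c) (hab : G.Adj a b) (hbc : G.Adj b c) :
    HasDetectedCycle G (insert a (insert b (insert c S))) (p + 1) := by
  obtain ⟨z, hz, hz0, f, hf, hfz⟩ := H
  have hne := G.ne_of_adj hab
  have hne' := G.ne_of_adj hbc
  obtain ⟨F, hF, hFf⟩ := hf.exists_extension ha hb hc hne hac hne'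
  refine ⟨(edgeGen a b - edgeGen b c) * z, ?_, ?_, F, hF, ?_⟩
  · rw [sub_mul]
    exact sub_mem
      (edgeGen_mul_mem_graphMatchingChains hab (by simp) (by simp) (by grind) hz)
      (edgeGen_mul_mem_graphMatchingChains hbc (by simp) (by simp) (by grind) hz)
  · simp [sub_mul, simplicialBoundary_edgeGen_mul, hz0]
  · rw [hFf p z (graphMatchingChains_le_matchingChains S p hz), hfz]

theorem hasDetectedCycle_of_bipartite (k : ℕ) (L R : Finset V) (hLR : Disjoint L R)
    (hadj : ∀ u ∈ L, ∀ v ∈ R, G.Adj u v) (hL : k ≤ L.card) (hR : k ≤ R.card)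
    (h1 : 3 * k ≤ L.card + R.card) (h2 : L.card + R.card ≤ 3 * k + 1) :
    HasDetectedCycle G (L ∪ R) k := by
  induction k generalizing L R with
  | zero =>
    obtain ⟨f, hf, hf1⟩ := exists_isTriangularCocycle_zero (S := L ∪ R)
      (by rw [Finset.card_union_of_disjoint hLR]; omega)
    refine ⟨1, Submodule.subset_span ⟨[], ⟨by simp, by simp, by simp, by simp⟩, rfl, ?_⟩,
      simplicialBoundary_one, f, hf, hf1⟩
    simp [orientedSimplex]
  | succ k ih =>
    -- The path takes its middle from the smaller part and its ends from the larger, so both parts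
    -- keep at least k vertices.
    wlog hle : L.card ≤ R.card generalizing L R
    · rw [Finset.union_comm]
      exact this R L hLR.symm (fun u hu v hv => (hadj v hv u hu).symm) hR hL (by omega) (by omega)
        (by omega)
    obtain ⟨b, hb⟩ := Finset.card_pos.1 (show 0 < L.card by omega)
    obtain ⟨a, ha, c, hc, hac⟩ := Finset.one_lt_card.1 (show 1 < R.card by omega)
    have hcL := Finset.card_erase_of_mem hb
    have hcR := Finset.card_erase_of_mem hc
    have hcR' := Finset.card_erase_of_mem (Finset.mem_erase.2 ⟨hac, ha⟩)
    have hd : ∀ x ∈ L, x ∉ R := fun x hx hx' => Finset.disjoint_left.1 hLR hx hx'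
    have hIH := ih (L.erase b) ((R.erase c).erase a)
      (Finset.disjoint_left.2 (by grind)) (fun u hu v hv => hadj u (by grind) v (by grind))
      (by omega) (by omega) (by omega) (by omega)
    have := hIH.extend (a := a) (b := b) (c := c) (by grind) (by grind) (by grind) hac
      (hadj b hb a ha).symm (hadj b hb c hc)
    convert this using 1
    grind

/-- The hexagon `M_{2,3}` joined with a detected cycle. -/
theorem HasDetectedCycle.exists_hexagon {S : Finset V} {p : ℕ} (H : HasDetectedCycle G S p)
    {v w x₁ x₂ x₃ : V} (hv : v ∉ S) (hw : w ∉ S) (h₁ : x₁ ∉ S) (h₂ : x₂ ∉ S) (h₃ : x₃ ∉ S)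
    (hvw : v ≠ w) (h₁₂ : x₁ ≠ x₂) (h₁₃ : x₁ ≠ x₃) (h₂₃ : x₂ ≠ x₃)
    (hadj : ∀ u ∈ ({v, w} : Finset V), ∀ x ∈ ({x₁, x₂, x₃} : Finset V), G.Adj u x) :
    ∃ z ∈ graphMatchingChains G (insert v (insert w (insert x₁ (insert x₂ (insert x₃ S))))) (p + 2),
      simplicialBoundary (Sym2 V) z = 0 ∧ ∃ f : MatchingCochain V,
      (∀ y ∈ matchingChains (insert v (insert w (insert x₁ (insert x₂ (insert x₃ S))))) (p + 3),
        f (simplicialBoundary (Sym2 V) y) = 0) ∧ f z = 1 := by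
  obtain ⟨z, hz, hz0, f, hf, hfz⟩ := H
  have hv1 : G.Adj v x₁ := hadj _ (by simp) _ (by simp)
  have hv2 : G.Adj v x₂ := hadj _ (by simp) _ (by simp)
  have hv3 : G.Adj v x₃ := hadj _ (by simp) _ (by simp)
  have hw1 : G.Adj w x₁ := hadj _ (by simp) _ (by simp)
  have hw2 : G.Adj w x₂ := hadj _ (by simp) _ (by simp)
  have hw3 : G.Adj w x₃ := hadj _ (by simp) _ (by simp)
  have nv1 := hv1.ne
  have nv2 := hv2.ne
  have nv3 := hv3.ne
  have nw1 := hw1.ne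
  have nw2 := hw2.ne
  have nw3 := hw3.ne
  obtain ⟨F, hF, hFf⟩ := hf.exists_extension h₂ hw h₃ nw2.symm h₂₃ nw3
  -- E is supported on matchings containing vx₁, where it is F of the rest. Removing an edge at v
  -- leaves a matching on which E vanishes, so E inherits the cocycle property from F.
  obtain ⟨E, hE0, hE1⟩ := exists_cochain_vertex (S := insert w (insert x₁ (insert x₂ (insert x₃ S))))
    (a := v) (by grind) 0 (fun u => if u = x₁ then F else 0)
  have hmw : ∀ x ∈ ({x₁, x₂, x₃} : Finset V),
      edgeGen w x * z ∈ graphMatchingChains G (insert w (insert x S)) (p + 1) := by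
    intro x hx
    refine edgeGen_mul_mem_graphMatchingChains (hadj w (by simp) x hx) (by simp) (by simp) ?_ hz
    grind
  have hmem : ∀ x ∈ ({x₁, x₂, x₃} : Finset V), ∀ x' ∈ ({x₁, x₂, x₃} : Finset V), x ≠ x' →
      edgeGen v x * (edgeGen w x' * z) ∈
        graphMatchingChains G (insert v (insert w (insert x₁ (insert x₂ (insert x₃ S))))) (p + 2) := by
    intro x hx x' hx' hne
    refine edgeGen_mul_mem_graphMatchingChains (hadj v (by simp) x hx) (by simp) (by grind) ?_
      (hmw x' hx')
    grind
  have hval : ∀ x ∈ ({x₁, x₂, x₃} : Finset V), ∀ x' ∈ ({x₁, x₂, x₃} : Finset V), x ≠ x' →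
      E (edgeGen v x * (edgeGen w x' * z)) = if x = x₁ then F (edgeGen w x' * z) else 0 := by
    intro x hx x' hx' hne
    rw [hE1 x (by grind) (p + 1) _ (graphMatchingChains_le_matchingChains _ _
      (graphMatchingChains_mono (by grind) _ (hmw x' hx')))]
    split_ifs <;> simp
  -- The fundamental cycle of the hexagon times z.
  refine ⟨(edgeGen v x₁ * (edgeGen w x₂ * z) - edgeGen v x₁ * (edgeGen w x₃ * z)) +
    (edgeGen v x₂ * (edgeGen w x₃ * z) - edgeGen v x₂ * (edgeGen w x₁ * z)) +
    (edgeGen v x₃ * (edgeGen w x₁ * z) - edgeGen v x₃ * (edgeGen w x₂ * z)), ?_, ?_, E, ?_, ?_⟩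
  · refine add_mem (add_mem (sub_mem ?_ ?_) (sub_mem ?_ ?_)) (sub_mem ?_ ?_) <;>
    · refine hmem _ (by simp) _ (by simp) ?_
      first
      | assumption
      | exact Ne.symm ‹_›
  · simp only [map_add, map_sub, simplicialBoundary_edgeGen_mul, hz0, mul_zero, sub_zero]
    abel
  · refine cochain_eq_zero_of_vertex (E ∘ₗ simplicialBoundary (Sym2 V)) ?_ ?_
    · intro y hy
      rw [LinearMap.comp_apply, hE0 _ _ (simplicialBoundary_mem hy), LinearMap.zero_apply]
    · intro u hu q hq y hy
      obtain rfl : q = p + 2 := by omega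
      rw [LinearMap.comp_apply, simplicialBoundary_edgeGen_mul, map_sub,
        hE0 _ _ (matchingChains_mono Finset.sdiff_subset _ hy),
        hE1 u hu _ _ (simplicialBoundary_mem hy)]
      split_ifs with hux
      · rw [hF.cocycle y (matchingChains_mono (by grind) _ hy)]
        simp
      · simp
  -- Only the two terms with vx₁ survive; they leave the path factor x₂w - wx₃, on which F returns f
  -- z.
  · have e := hFf p z (graphMatchingChains_le_matchingChains S p hz)
    rw [sub_mul, map_sub, edgeGen_comm x₂ w, hfz] at e
    rw [map_add, map_add, map_sub, map_sub, map_sub,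
      hval x₁ (by simp) x₂ (by simp) h₁₂, hval x₁ (by simp) x₃ (by simp) h₁₃,
      hval x₂ (by simp) x₃ (by simp) h₂₃, hval x₂ (by simp) x₁ (by simp) h₁₂.symm,
      hval x₃ (by simp) x₁ (by simp) h₁₃.symm, hval x₃ (by simp) x₂ (by simp) h₂₃.symm]
    simp [h₁₂.symm, h₁₃.symm, e]

variable [Fintype V]

/-- If the vertices of `G` can be split into two completely joined parts with more than `ν` vertices,
where `ν = (#V + 1) / 3 - 1`, then the matching complex of `G` has homology in degree `ν`. -/
theorem nontrivial_reducedHomology_of_bipartite (k : ℕ) (L R : Finset V) (hLR : Disjoint L R)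
    (hun : L ∪ R = Finset.univ) (hadj : ∀ u ∈ L, ∀ v ∈ R, G.Adj u v) (hL : k + 1 ≤ L.card)
    (hR : k + 1 ≤ R.card) (h3 : 3 ≤ L.card + R.card) (h1 : 3 * k + 2 ≤ L.card + R.card)
    (h2 : L.card + R.card ≤ 3 * k + 4) :
    Nontrivial (reducedHomology (matchingComplexOf G) k) := by
  by_cases hN : 3 * (k + 1) ≤ L.card + R.card
  · obtain ⟨z, hz, hz0, f, hf, hfz⟩ :=
      hasDetectedCycle_of_bipartite (k + 1) L R hLR hadj hL hR hN (by omega)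
    rw [hun] at hz hf
    exact nontrivial_reducedHomology (p := k + 1) (by push_cast; rfl) hz hz0 f
      (fun w hw => hf.cocycle w (graphMatchingChains_le_matchingChains _ _ hw)) (by simp [hfz])
  -- There are exactly 3k + 2 vertices, and `h3` excludes k = 0. The hexagon takes two vertices of
  -- the smaller part and three of the larger, leaving 3(k - 1).
  · obtain ⟨k, rfl⟩ : ∃ j, k = j + 1 := ⟨k - 1, by omega⟩
    wlog hle : L.card ≤ R.card generalizing L R
    · exact this R L hLR.symm (by rwa [Finset.union_comm])
        (fun u hu v hv => (hadj v hv u hu).symm) (by omega) (by omega) (by omega) (by omega)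
        (by omega) (by omega) (by omega)
    obtain ⟨v, hv, w, hw, hvw⟩ := Finset.one_lt_card.1 (show 1 < L.card by omega)
    obtain ⟨x₁, x₂, x₃, h₁, h₂, h₃, h₁₂, h₁₃, h₂₃⟩ := Finset.two_lt_card_iff.1 (show 2 < R.card by omega)
    have hd : ∀ x ∈ L, x ∉ R := fun x hx hx' => Finset.disjoint_left.1 hLR hx hx'
    have hcL : (L \ {v, w}).card = L.card - 2 := by
      rw [Finset.card_sdiff_of_subset (by grind), Finset.card_pair hvw]
    have hcR : (R \ {x₁, x₂, x₃}).card = R.card - 3 := by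
      rw [Finset.card_sdiff_of_subset (by grind),
        Finset.card_eq_three.2 ⟨x₁, x₂, x₃, h₁₂, h₁₃, h₂₃, rfl⟩]
    have hS := hasDetectedCycle_of_bipartite (G := G) k (L \ {v, w}) (R \ {x₁, x₂, x₃})
      (Finset.disjoint_left.2 (by grind)) (fun u hu x hx => hadj u (by grind) x (by grind))
      (by omega) (by omega) (by omega) (by omega)
    obtain ⟨z, hz, hz0, f, hf, hfz⟩ := hS.exists_hexagon (v := v) (w := w) (x₁ := x₁) (x₂ := x₂)
      (x₃ := x₃) (by grind) (by grind) (by grind) (by grind) (by grind) hvw h₁₂ h₁₃ h₂₃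
      (fun u hu x hx => hadj u (by grind) x (by grind))
    have hSu : insert v (insert w (insert x₁ (insert x₂ (insert x₃
        (L \ {v, w} ∪ R \ {x₁, x₂, x₃}))))) = Finset.univ := by
      rw [← hun]
      grind
    rw [hSu] at hz hf
    exact nontrivial_reducedHomology (p := k + 2) (by push_cast; ring) hz hz0 f
      (fun w hw => hf w (graphMatchingChains_le_matchingChains _ _ hw)) (by simp [hfz])

/-- If all edges of `G` meet `L` and `L` is completely joined to a set with twice as many vertices, then
the matching complex of `G` has homology in its top degree `#L - 1`. -/
theorem nontrivial_reducedHomology_of_vertexCover (L R : Finset V) (hLR : Disjoint L R)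
    (hadj : ∀ u ∈ L, ∀ v ∈ R, G.Adj u v) (hcov : ∀ e ∈ G.edgeSet, ∃ u ∈ L, u ∈ e)
    (hR : 2 * L.card ≤ R.card) :
    Nontrivial (reducedHomology (matchingComplexOf G) ((L.card : ℤ) - 1)) := by
  -- With exactly 2 #L vertices kept, the cycle lives on 3 #L vertices and has #L edges.
  obtain ⟨R', hR', hcard⟩ := Finset.exists_subset_card_eq hR
  obtain ⟨z, hz, hz0, f, hf, hfz⟩ := hasDetectedCycle_of_bipartite (G := G) L.card L R'
    (hLR.mono_right hR') (fun u hu v hv => hadj u hu v (hR' hv)) le_rfl (by omega) (by omega)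
    (by omega)
  refine nontrivial_reducedHomology (p := L.card) (by ring)
    (graphMatchingChains_mono (Finset.subset_univ _) _ hz) hz0 f (fun w hw => ?_) (by simp [hfz])
  -- By the pigeonhole principle two of #L + 1 edges would share a vertex of L, so every cochain is
  -- a cocycle in this degree.
  have : graphMatchingChains G Finset.univ (L.card + 1) ≤ ⊥ := by
    refine Submodule.span_le.2 ?_
    rintro w ⟨l, hl, hp, rfl⟩
    exfalso
    obtain ⟨e₀, he₀⟩ := List.exists_mem_of_length_pos (show 0 < l.length by omega)
    have : Nonempty V := ⟨(hcov e₀ (hl.edge e₀ he₀)).choose⟩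
    choose! φ hφL hφ using hcov
    obtain ⟨e, he, e', he', hne, heq⟩ := Finset.exists_ne_map_eq_of_card_lt_of_maps_to
      (s := l.toFinset) (t := L) (f := φ) (by rw [List.toFinset_card_of_nodup hl.nodup]; omega)
      (fun e he => hφL e (hl.edge e (List.mem_toFinset.1 he)))
    rw [List.mem_toFinset] at he he'
    exact hne (hl.disj (φ e) e he e' he' (hφ e (hl.edge e he))
      (heq ▸ hφ e' (hl.edge e' he')))
  rw [(Submodule.mem_bot ℤ).1 (this hw), map_zero, map_zero]

end Homology

/-! ### Complete graphs and chessboards -/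

theorem theorem3p1 :
    (∀ n : ℕ, 3 ≤ n → Nontrivial (reducedHomology (matchingComplex n) (nuMatching n))) ∧
    (∀ m n : ℕ, 3 ≤ m + n →
      Nontrivial (reducedHomology (chessboardComplex m n) (nuChessboard m n))) := by
  constructor
  · intro n hn
    -- Two nearly equal halves leave enough room for a cycle that uses only edges between them.
    obtain ⟨L, -, hL⟩ := Finset.exists_subset_card_eq
      (show n / 2 ≤ (Finset.univ : Finset (Fin n)).card by simp; omega)
    have hLc : Lᶜ.card = n - n / 2 := by rw [Finset.card_compl, hL, Fintype.card_fin]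
    have hnu : nuMatching n = (((n + 1) / 3 - 1 : ℕ) : ℤ) := by
      unfold nuMatching
      omega
    rw [hnu]
    exact nontrivial_reducedHomology_of_bipartite _ L Lᶜ disjoint_compl_right
      (Finset.union_compl L)
      (fun u hu v hv => by
        rw [SimpleGraph.top_adj]
        rintro rfl
        exact Finset.mem_compl.1 hv hu)
      (by omega) (by omega) (by omega) (by omega) (by omega)
  · intro m n hmn
    let L : Finset (Fin m ⊕ Fin n) := Finset.univ.map Function.Embedding.inl
    let R : Finset (Fin m ⊕ Fin n) := Finset.univ.map Function.Embedding.inr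
    have hL : L.card = m := by simp [L]
    have hR : R.card = n := by simp [R]
    have hLR : Disjoint L R := Finset.disjoint_left.2 (by simp [L, R])
    have hun : L ∪ R = Finset.univ := by
      ext (x | x) <;> simp [L, R]
    have hadj : ∀ u ∈ L, ∀ v ∈ R, (completeBipartiteGraph (Fin m) (Fin n)).Adj u v := by
      simp [L, R]
    have hcovL : ∀ e ∈ (completeBipartiteGraph (Fin m) (Fin n)).edgeSet, ∃ u ∈ L, u ∈ e := by
      intro e he
      induction e using Sym2.ind with
      | _ x y => rcases x with x | x <;> rcases y with y | y <;> simp_all [L]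
    have hcovR : ∀ e ∈ (completeBipartiteGraph (Fin m) (Fin n)).edgeSet, ∃ u ∈ R, u ∈ e := by
      intro e he
      induction e using Sym2.ind with
      | _ x y => rcases x with x | x <;> rcases y with y | y <;> simp_all [R]
    -- The minimum is m if 2m ≤ n, n if 2n ≤ m, and the third term otherwise.
    rcases le_or_gt (2 * m) n with h | h
    · have hnu : nuChessboard m n = (L.card : ℤ) - 1 := by
        unfold nuChessboard
        omega
      rw [hnu]
      exact nontrivial_reducedHomology_of_vertexCover L R hLR hadj hcovL (by omega)
    rcases le_or_gt (2 * n) m with h' | h'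
    · have hnu : nuChessboard m n = (R.card : ℤ) - 1 := by
        unfold nuChessboard
        omega
      rw [hnu]
      exact nontrivial_reducedHomology_of_vertexCover R L hLR.symm
        (fun u hu v hv => (hadj v hv u hu).symm) hcovR (by omega)
    have hnu : nuChessboard m n = (((m + n + 1) / 3 - 1 : ℕ) : ℤ) := by
      unfold nuChessboard
      omega
    rw [hnu]
    exact nontrivial_reducedHomology_of_bipartite _ L R hLR hun hadj
      (by omega) (by omega) (by omega) (by omega) (by omega)
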